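/- Let $\Sigma$ be the infinite trivalent planar lattice drawn as a brick wall (the honeycomb lattice): its vertex set is $V=\mathbb{Z}^2$, each $(i,j)$ is joined to $(i\pm1,j)$, and $(i,j)$ is joined to $(i,j+1)$ whenever $i+j$ is even. Its faces are the bricks: the face $f$ with lower left corner $(i,j)$, $i+j$ even, has the six vertices $\partial f=\{(i+k,j+l): k\in\{0,1,2\},\ l\in\{0,1\}\}$. The translations of $\Sigma$ are the translations by $t\in\mathbb{Z}^2$ with $t_1+t_2$ even. For finite $\Lambda\subset V$ let $\mathcal{A}(\Lambda)=\bigotimes_{v\in\Lambda}M_2(\mathbb{C})$, let $\mathcal{A}_{\rm loc}=\bigcup_{\Lambda}\mathcal{A}(\Lambda)$ under the inclusions $A\mapsto A\otimes\mathbb{1}$, and let the quasi-local algebra $\mathcal{A}$ be the norm completion of $\mathcal{A}_{\rm loc}$. For each face $f$ put $K_f=\bigotimes_{v\in\partial f}\sigma^{x}_v$ and $J_f=\bigotimes_{v\in\partial f}\sigma^{z}_v$. For finite $\Lambda$ let $H_\Lambda=-\sum_{f:\,\partial f\subset\Lambda}(K_f+J_f)$, and for $A\in\mathcal{A}_{\rm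 loc}$ let $\delta(A)=\lim_{\Lambda\uparrow V} i[H_\Lambda,A]$ (the net is eventually constant). A state on $\mathcal{A}$ is a linear functional $\omega$ with $\omega(A^*A)\ge 0$ for all $A\in\mathcal{A}$ and $\omega(\mathbb{1})=1$. A ground state is a state $\omega$ with $-i\,\omega(A^*\delta(A))\ge 0$ for all $A\in\mathcal{A}_{\rm loc}$. A state $\omega$ is pure if every positive linear functional $\varphi$ on $\mathcal{A}$ with $\omega-\varphi$ positive is a scalar multiple of $\omega$. **Theorem.** There is exactly one ground state $\omega_0$ on $\mathcal{A}$ that is invariant under all translations of $\Sigma$. It satisfies $\omega_0(K_f)=\omega_0(J_f)=1$ for every face $f$, it is the only state on $\mathcal{A}$ with this property, and it is a pure state. -/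

import Mathlib

open scoped ComplexOrder

noncomputable section

namespace ColorCode

/-! ### The lattice

The trivalent lattice is drawn as a brick wall: the vertices are the points of `ℤ × ℤ`,
`(i, j)` is joined to `(i ± 1, j)`, and `(i, j)` is joined to `(i, j + 1)` when `i + j` is even.
It is the honeycomb lattice; its faces are the bricks. -/

/-- The vertices of the lattice; each carries a qubit. -/
abbrev Site : Type := ℤ × ℤ

/-- The faces of the lattice. A brick is recorded by its lower left corner `(i, j)`,
and `i + j` is even because a vertical edge leaves that corner upwards. -/
abbrev Face : Type := {c : ℤ × ℤ // Even (c.1 + c.2)}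

/-- The six vertices of a face. -/
def Face.vertices (f : Face) : Finset Site :=
  {(f.1.1, f.1.2), (f.1.1 + 1, f.1.2), (f.1.1 + 2, f.1.2),
    (f.1.1, f.1.2 + 1), (f.1.1 + 1, f.1.2 + 1), (f.1.1 + 2, f.1.2 + 1)}

/-- The translations of the plane that preserve the lattice. -/
abbrev LatticeTranslation : Type := {t : ℤ × ℤ // Even (t.1 + t.2)}

/-! ### The local matrix algebras -/

/-- The algebra `⊗_{v ∈ Λ} M₂(ℂ)` of observables of a finite region `Λ`, as matrices over the
product basis of `⊗_{v ∈ Λ} ℂ²`. -/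
abbrev LocalMatrix (Λ : Finset Site) : Type := Matrix (Λ → Fin 2) (Λ → Fin 2) ℂ

/-- The elementary tensor `⊗_{v ∈ Λ} σ_v` with the same factor `σ` at each site. -/
def tensorPower (Λ : Finset Site) (σ : Matrix (Fin 2) (Fin 2) ℂ) : LocalMatrix Λ :=
  Matrix.of fun x y => ∏ v, σ (x v) (y v)

/-- The Pauli matrix `σˣ`. -/
def pauliX : Matrix (Fin 2) (Fin 2) ℂ := !![0, 1; 1, 0]

/-- The Pauli matrix `σᶻ`. -/
def pauliZ : Matrix (Fin 2) (Fin 2) ℂ := !![1, 0; 0, -1]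

/-- The inclusion `A ↦ A ⊗ 1` of the matrices over `Λ₁` into the matrices over `Λ₂ ⊇ Λ₁`. -/
def extendMatrix {Λ₁ Λ₂ : Finset Site} (h : Λ₁ ⊆ Λ₂) (M : LocalMatrix Λ₁) : LocalMatrix Λ₂ :=
  open Classical in
  Matrix.of fun x y =>
    if ∀ v : Λ₂, v.1 ∉ Λ₁ → x v = y v then
      M (fun v => x ⟨v.1, h v.2⟩) (fun v => y ⟨v.1, h v.2⟩) else 0

/-! ### The Hilbert space on which the local observables are realized

Its orthonormal basis consists of the product vectors with all but finitely many spins up.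
Every local matrix algebra acts on it faithfully, hence isometrically (`localRep_injective`, `norm_localRep`),
compatibly with the inclusions `A ↦ A ⊗ 1` (`localRep_extendMatrix`). So the norm closure of the
union of the local algebras is the completed inductive limit of the matrix algebras. -/

/-- Configurations of spins with all but finitely many spins up (`0`). -/
abbrev Config : Type := Site →₀ Fin 2

/-- `ℓ²` over the configurations: the infinite tensor product of `ℂ²` along the vectors `|0⟩`. -/
abbrev SpinSpace : Type := lp (fun _ : Config => ℂ) 2

/-- The bounded operators on `SpinSpace`. -/
abbrev Op : Type := SpinSpace →L[ℂ] SpinSpace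

/-- The configuration that is `x` on `Λ` and `s` off `Λ`. -/
def splice (Λ : Finset Site) (x : Λ → Fin 2) (s : Config) : Config :=
  Finsupp.onFinset (s.support ∪ Λ) (fun v => if h : v ∈ Λ then x ⟨v, h⟩ else s v) (by
    intro v hv
    by_cases h : v ∈ Λ
    · simp [h]
    · simp only [h, dif_neg, not_false_eq_true] at hv
      simp [hv])

/-- The restriction of a configuration to `Λ`. -/
def restr (Λ : Finset Site) (s : Config) : Λ → Fin 2 := fun v => s v

theorem splice_apply (Λ : Finset Site) (x : Λ → Fin 2) (s : Config) (v : Site) :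
    splice Λ x s v = if h : v ∈ Λ then x ⟨v, h⟩ else s v := rfl

@[simp] theorem restr_splice (Λ : Finset Site) (x : Λ → Fin 2) (s : Config) :
    restr Λ (splice Λ x s) = x := by
  funext v
  simp [restr, splice_apply]

@[simp] theorem splice_splice (Λ : Finset Site) (x y : Λ → Fin 2) (s : Config) :
    splice Λ x (splice Λ y s) = splice Λ x s := by
  ext v
  by_cases h : v ∈ Λ <;> simp [splice_apply, h]

@[simp] theorem splice_restr (Λ : Finset Site) (s : Config) : splice Λ (restr Λ s) s = s := by
  ext v
  by_cases h : v ∈ Λ <;> simp [splice_apply, restr]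

/-- The action of a partial bijection `g` of the configurations on `ψ` is `ψ ∘ g`, extended by
zero. -/
def pullFun (g : Config ≃. Config) (ψ : Config → ℂ) : Config → ℂ := fun s => (g s).elim 0 ψ

theorem sum_pullFun_le (g : Config ≃. Config) (ψ : SpinSpace) (S : Finset Config) :
    ∑ s ∈ S, ‖pullFun g ψ s‖ ^ (2 : ENNReal).toReal ≤ ‖ψ‖ ^ (2 : ENNReal).toReal := by
  classical
  have h2 : (0 : ℝ) < (2 : ENNReal).toReal := by simp
  have key : ∑ s ∈ S, ‖pullFun g ψ s‖ ^ (2 : ENNReal).toReal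
      = ∑ t ∈ S.biUnion (fun s => (g s).toFinset), ‖ψ t‖ ^ (2 : ENNReal).toReal := by
    rw [Finset.sum_biUnion]
    · refine Finset.sum_congr rfl fun s _ => ?_
      cases hs : g s <;> simp [pullFun, hs]
    · intro a _ b _ hab
      rw [Function.onFun, Finset.disjoint_left]
      intro t ha hb
      rw [Option.mem_toFinset] at ha hb
      exact hab (g.inj ha hb)
  rw [key]
  exact lp.sum_rpow_le_norm_rpow h2 ψ _

/-- The partial isometry `ψ ↦ ψ ∘ g` of `SpinSpace`. -/
def pull (g : Config ≃. Config) : Op :=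
  LinearMap.mkContinuous
    { toFun := fun ψ => (⟨pullFun g ψ, memℓp_gen' (sum_pullFun_le g ψ)⟩ : SpinSpace)
      map_add' := by
        intro ψ φ
        ext s
        change pullFun g (⇑(ψ + φ)) s = pullFun g ψ s + pullFun g φ s
        unfold pullFun
        cases g s with
        | none => exact (add_zero (0 : ℂ)).symm
        | some t => rfl
      map_smul' := by
        intro c ψ
        ext s
        change pullFun g (⇑(c • ψ)) s = c • pullFun g ψ s
        unfold pullFun
        cases g s <;> simp }
    1 (by
      intro ψ
      rw [one_mul]
      exact lp.norm_le_of_forall_sum_le (by simp) (norm_nonneg _) (sum_pullFun_le g ψ))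

theorem pull_apply (g : Config ≃. Config) (ψ : SpinSpace) (s : Config) :
    pull g ψ s = (g s).elim 0 ψ := rfl

theorem star_pull (g : Config ≃. Config) : star (pull g) = pull g.symm := by
  classical
  have hs : ∀ s, pull g (lp.single 2 s (1 : ℂ)) = (g.symm s).elim 0 (fun t => lp.single 2 t 1) := by
    intro s
    ext t
    rw [pull_apply]
    cases hg : g.symm s with
    | none =>
      cases ht : g t with
      | none => simp
      | some u =>
        have : u ≠ s := by
          rintro rfl
          rw [(g.eq_some_iff).2 ht] at hg
          cases hg
        simp [this]
    | some r =>
      have hr := (g.eq_some_iff).1 hg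
      cases ht : g t with
      | none =>
        have : t ≠ r := by rintro rfl; rw [hr] at ht; cases ht
        simp [this]
      | some u =>
        by_cases htr : t = r
        · subst htr
          rw [hr] at ht
          cases ht
          simp
        · have : u ≠ s := by
            rintro rfl
            exact htr (g.inj ht hr)
          simp [this, htr]
  ext ψ s
  have h1 : inner ℂ (lp.single 2 s (1 : ℂ)) (star (pull g) ψ) = star (pull g) ψ s := by
    rw [lp.inner_single_left]; simp
  rw [← h1, ContinuousLinearMap.star_eq_adjoint, ContinuousLinearMap.adjoint_inner_right, hs,
    pull_apply]
  cases g.symm s with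
  | none => simp
  | some t =>
    simp only [Option.elim]
    rw [lp.inner_single_left]; simp

/-- The matrix unit `|x⟩⟨y|` on `Λ`, as a partial bijection of the configurations. -/
def unitPEquiv (Λ : Finset Site) (x y : Λ → Fin 2) : Config ≃. Config where
  toFun s := if restr Λ s = x then some (splice Λ y s) else none
  invFun s := if restr Λ s = y then some (splice Λ x s) else none
  inv := by
    intro s t
    constructor
    · intro h
      by_cases ht : restr Λ t = y
      · simp only [ht, if_true, Option.some.injEq] at h
        subst h
        subst ht
        simp
      · simp [ht] at h
    · intro h
      by_cases hs : restr Λ s = x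
      · simp only [hs, if_true, Option.some.injEq] at h
        subst h
        subst hs
        simp
      · simp [hs] at h

/-- The action `M ⊗ 1` of a local matrix on `SpinSpace`. -/
def localOp (Λ : Finset Site) (M : LocalMatrix Λ) : Op :=
  ∑ x, ∑ y, M x y • pull (unitPEquiv Λ x y)

theorem localOp_apply (Λ : Finset Site) (M : LocalMatrix Λ) (ψ : SpinSpace) (s : Config) :
    localOp Λ M ψ s = ∑ y, M (restr Λ s) y * ψ (splice Λ y s) := by
  classical
  have hp : ∀ x y, pull (unitPEquiv Λ x y) ψ s
      = if restr Λ s = x then ψ (splice Λ y s) else 0 := by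
    intro x y
    rw [pull_apply]
    change Option.elim (if restr Λ s = x then some (splice Λ y s) else none) 0 ψ = _
    split_ifs <;> rfl
  simp only [localOp, sum_apply, smul_apply,
    lp.coeFn_sum, Finset.sum_apply, lp.coeFn_smul, Pi.smul_apply, hp, smul_eq_mul]
  rw [Finset.sum_comm]
  refine Finset.sum_congr rfl fun y _ => ?_
  simp

/-- The action of the matrix algebra over `Λ` on `SpinSpace`, as a unital `*`-homomorphism. -/
def localRep (Λ : Finset Site) : LocalMatrix Λ →⋆ₐ[ℂ] Op where
  toFun := localOp Λ
  map_one' := by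
    ext ψ s
    rw [localOp_apply]
    simp [Matrix.one_apply]
  map_mul' M N := by
    ext ψ s
    rw [mul_apply_eq_comp, localOp_apply, localOp_apply]
    simp only [localOp_apply, restr_splice, splice_splice, Matrix.mul_apply, Finset.sum_mul,
      Finset.mul_sum]
    rw [Finset.sum_comm]
    simp only [mul_assoc]
  map_zero' := by simp [localOp]
  map_add' M N := by simp [localOp, add_smul, Finset.sum_add_distrib]
  commutes' c := by
    ext ψ s
    rw [localOp_apply]
    simp [Matrix.algebraMap_matrix_apply, Algebra.algebraMap_eq_smul_one]
  map_star' M := by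
    simp only [localOp, star_sum, star_smul, star_pull]
    rw [Finset.sum_comm]
    rfl

theorem localRep_apply (Λ : Finset Site) (M : LocalMatrix Λ) (ψ : SpinSpace) (s : Config) :
    localRep Λ M ψ s = ∑ y, M (restr Λ s) y * ψ (splice Λ y s) :=
  localOp_apply Λ M ψ s

theorem localRep_injective (Λ : Finset Site) : Function.Injective (localRep Λ) := by
  classical
  intro M N h
  ext x y
  have hM : ∀ M : LocalMatrix Λ,
      localRep Λ M (lp.single 2 (splice Λ y 0) (1 : ℂ)) (splice Λ x 0) = M x y := by
    intro M
    rw [localRep_apply]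
    have : ∀ z, splice Λ z (0 : Config) = splice Λ y 0 ↔ z = y := fun z =>
      ⟨fun hz => by simpa using congrArg (restr Λ) hz, fun hz => by rw [hz]⟩
    simp [Pi.single_apply, this]
  rw [← hM M, ← hM N, h]

open scoped Matrix.Norms.L2Operator in
theorem norm_localRep (Λ : Finset Site) (M : LocalMatrix Λ) : ‖localRep Λ M‖ = ‖M‖ := by
  have hc : IsClosed ((localRep Λ).range : Set Op) :=
    ((localRep Λ).toAlgHom.toLinearMap.range).closed_of_finiteDimensional
  let _ := StarSubalgebra.cstarAlgebra (localRep Λ).range (h_closed := hc)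
  exact StarAlgEquiv.norm_map (StarAlgEquiv.ofInjective (localRep Λ) (localRep_injective Λ)) M

theorem localRep_extendMatrix {Λ₁ Λ₂ : Finset Site} (h : Λ₁ ⊆ Λ₂) (M : LocalMatrix Λ₁) :
    localRep Λ₂ (extendMatrix h M) = localRep Λ₁ M := by
  classical
  ext ψ s
  rw [localRep_apply, localRep_apply]
  symm
  refine Finset.sum_of_injOn (fun y v => if hv : v.1 ∈ Λ₁ then y ⟨v.1, hv⟩ else s v) ?_ ?_ ?_ ?_
  · intro y _ z _ hyz
    funext v
    have := congrFun hyz ⟨v.1, h v.2⟩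
    simpa using this
  · intro y _
    simp
  · intro y _ hy
    have : ¬ ∀ v : Λ₂, v.1 ∉ Λ₁ → restr Λ₂ s v = y v := by
      intro hall
      apply hy
      refine ⟨fun v => y ⟨v.1, h v.2⟩, by simp, ?_⟩
      funext v
      by_cases hv : v.1 ∈ Λ₁
      · simp [hv]
      · simpa [hv, restr] using hall v hv
    simp only [extendMatrix, Matrix.of_apply]
    rw [if_neg this, zero_mul]
  · intro y _
    have h1 : ∀ v : Λ₂, v.1 ∉ Λ₁ →
        restr Λ₂ s v = if hv : v.1 ∈ Λ₁ then y ⟨v.1, hv⟩ else s v := by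
      intro v hv
      simp [hv, restr]
    have h2 : splice Λ₂ (fun v => if hv : v.1 ∈ Λ₁ then y ⟨v.1, hv⟩ else s v) s
        = splice Λ₁ y s := by
      ext v
      by_cases hv : v ∈ Λ₁
      · simp [splice_apply, hv, h hv]
      · by_cases hv2 : v ∈ Λ₂ <;> simp [splice_apply, hv]
    rw [h2]
    simp only [extendMatrix, Matrix.of_apply]
    rw [if_pos h1]
    congr 2
    funext v
    simp

/-! ### The quasi-local algebra -/

/-- The algebra `𝒜(Λ)` of observables localized in the finite region `Λ`. -/
def localAlgebra (Λ : Finset Site) : StarSubalgebra ℂ Op := (localRep Λ).range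

theorem localAlgebra_mono {Λ₁ Λ₂ : Finset Site} (h : Λ₁ ⊆ Λ₂) :
    localAlgebra Λ₁ ≤ localAlgebra Λ₂ := by
  rintro _ ⟨M, rfl⟩
  exact ⟨extendMatrix h M, localRep_extendMatrix h M⟩

/-- The algebra `𝒜_loc` of local observables, the union of all `𝒜(Λ)` with `Λ` finite. -/
def localObservables : StarSubalgebra ℂ Op where
  carrier := ⋃ Λ : Finset Site, (localAlgebra Λ : Set Op)
  mul_mem' := by
    classical
    intro A B hA hB
    obtain ⟨Λ₁, hA⟩ := Set.mem_iUnion.1 hA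
    obtain ⟨Λ₂, hB⟩ := Set.mem_iUnion.1 hB
    exact Set.mem_iUnion.2 ⟨Λ₁ ∪ Λ₂, mul_mem (localAlgebra_mono Finset.subset_union_left hA)
      (localAlgebra_mono Finset.subset_union_right hB)⟩
  add_mem' := by
    classical
    intro A B hA hB
    obtain ⟨Λ₁, hA⟩ := Set.mem_iUnion.1 hA
    obtain ⟨Λ₂, hB⟩ := Set.mem_iUnion.1 hB
    exact Set.mem_iUnion.2 ⟨Λ₁ ∪ Λ₂, add_mem (localAlgebra_mono Finset.subset_union_left hA)
      (localAlgebra_mono Finset.subset_union_right hB)⟩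
  algebraMap_mem' c := Set.mem_iUnion.2 ⟨∅, algebraMap_mem _ c⟩
  star_mem' := by
    intro A hA
    obtain ⟨Λ, hA⟩ := Set.mem_iUnion.1 hA
    exact Set.mem_iUnion.2 ⟨Λ, star_mem hA⟩

/-- The quasi-local algebra `𝒜`, the norm closure of `𝒜_loc`. -/
def quasiLocal : StarSubalgebra ℂ Op := localObservables.topologicalClosure

/-- The quasi-local algebra as a type; it is a unital C*-algebra. -/
abbrev QLA : Type := quasiLocal

theorem localRep_mem_quasiLocal (Λ : Finset Site) (M : LocalMatrix Λ) :
    localRep Λ M ∈ quasiLocal :=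
  localObservables.le_topologicalClosure (Set.mem_iUnion.2 ⟨Λ, M, rfl⟩)

/-- The element of the quasi-local algebra given by a local matrix. -/
def toQLA (Λ : Finset Site) (M : LocalMatrix Λ) : QLA :=
  ⟨localRep Λ M, localRep_mem_quasiLocal Λ M⟩

/-! ### Translations -/

/-- The translation of configurations by `t`: the spin at `v` is moved to `v + t`. -/
def shift (t : Site) : Config ≃ Config := Finsupp.equivCongrLeft (Equiv.addRight t)

theorem shift_apply (t : Site) (s : Config) (v : Site) : shift t s v = s (v - t) := by
  simp [shift, Finsupp.equivMapDomain_apply, sub_eq_add_neg]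

/-- The unitary on `SpinSpace` that moves the basis vector of `s` to that of `shift t s`. -/
def shiftOp (t : Site) : Op := pull (shift t).symm.toPEquiv

theorem shiftOp_apply (t : Site) (ψ : SpinSpace) (s : Config) :
    shiftOp t ψ s = ψ ((shift t).symm s) := rfl

theorem star_shiftOp_apply (t : Site) (ψ : SpinSpace) (s : Config) :
    star (shiftOp t) ψ s = ψ (shift t s) := by
  rw [shiftOp, star_pull]; rfl

theorem star_shiftOp_mul (t : Site) : star (shiftOp t) * shiftOp t = 1 := by
  ext ψ s
  rw [mul_apply_eq_comp, star_shiftOp_apply, shiftOp_apply]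
  simp

theorem shiftOp_mul_star (t : Site) : shiftOp t * star (shiftOp t) = 1 := by
  ext ψ s
  rw [mul_apply_eq_comp, shiftOp_apply, star_shiftOp_apply]
  simp

/-- Conjugation by the translation unitary. -/
def conjShift (t : Site) : Op →⋆ₐ[ℂ] Op where
  toFun A := shiftOp t * A * star (shiftOp t)
  map_one' := by rw [mul_one, shiftOp_mul_star]
  map_mul' A B := by
    calc shiftOp t * (A * B) * star (shiftOp t)
        = shiftOp t * A * 1 * (B * star (shiftOp t)) := by noncomm_ring
      _ = _ := by rw [← star_shiftOp_mul t]; noncomm_ring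
  map_zero' := by simp
  map_add' A B := by noncomm_ring
  commutes' c := by
    rw [← Algebra.commutes c (shiftOp t), mul_assoc, shiftOp_mul_star, mul_one]
  map_star' A := by simp [mul_assoc]

theorem conjShift_apply (t : Site) (A : Op) :
    conjShift t A = shiftOp t * A * star (shiftOp t) := rfl

/-- The translate of a finite region. -/
def translateRegion (t : Site) (Λ : Finset Site) : Finset Site :=
  Λ.map (Equiv.addRight t).toEmbedding

theorem mem_translateRegion {t : Site} {Λ : Finset Site} {v : Site} (hv : v ∈ Λ) :
    v + t ∈ translateRegion t Λ := by
  simpa [translateRegion] using hv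

theorem sub_mem_of_mem_translateRegion {t : Site} {Λ : Finset Site} {v : Site}
    (hv : v ∈ translateRegion t Λ) : v - t ∈ Λ := by
  simpa [translateRegion, sub_eq_add_neg] using hv

/-- The spins over `Λ` and over `Λ + t` are identified. -/
def regionSpins (t : Site) (Λ : Finset Site) :
    (translateRegion t Λ → Fin 2) ≃ (Λ → Fin 2) where
  toFun x v := x ⟨v.1 + t, mem_translateRegion v.2⟩
  invFun x v := x ⟨v.1 - t, sub_mem_of_mem_translateRegion v.2⟩
  left_inv x := by funext v; simp
  right_inv x := by funext v; simp

/-- A translation moves a local matrix over `Λ` to the same matrix over `Λ + t`. -/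
theorem conjShift_localRep (t : Site) (Λ : Finset Site) (M : LocalMatrix Λ) :
    conjShift t (localRep Λ M) =
      localRep (translateRegion t Λ) (M.submatrix (regionSpins t Λ) (regionSpins t Λ)) := by
  ext ψ s
  rw [conjShift_apply, mul_apply_eq_comp, mul_apply_eq_comp, shiftOp_apply,
    localRep_apply, localRep_apply]
  symm
  refine Fintype.sum_equiv (regionSpins t Λ) _ _ fun y => ?_
  rw [star_shiftOp_apply, Matrix.submatrix_apply]
  have hsymm : ∀ v, (shift t).symm s v = s (v + t) := by
    intro v
    have := shift_apply t ((shift t).symm s) (v + t)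
    simpa using this.symm
  have h1 : (regionSpins t Λ) (restr (translateRegion t Λ) s) = restr Λ ((shift t).symm s) := by
    funext v
    simp [regionSpins, restr, hsymm]
  rw [h1]
  refine congrArg (fun c => M (restr Λ ((shift t).symm s)) (regionSpins t Λ y) * ψ c) ?_
  ext v
  rw [shift_apply, splice_apply, splice_apply, hsymm]
  by_cases hv : v ∈ translateRegion t Λ
  · simp [hv, sub_mem_of_mem_translateRegion hv, regionSpins]
  · have : v - t ∉ Λ := fun h => hv (by simpa using mem_translateRegion (t := t) h)
    simp [hv, this]

theorem conjShift_mem (t : Site) {A : Op} (hA : A ∈ quasiLocal) :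
    conjShift t A ∈ quasiLocal := by
  have hc : Continuous (conjShift t) := by
    change Continuous fun A : Op => shiftOp t * A * star (shiftOp t)
    fun_prop
  have hm : Set.MapsTo (conjShift t) (localObservables : Set Op) (localObservables : Set Op) := by
    intro B hB
    obtain ⟨Λ, M, rfl⟩ := Set.mem_iUnion.1 hB
    exact Set.mem_iUnion.2 ⟨translateRegion t Λ, _, (conjShift_localRep t Λ M).symm⟩
  exact hm.closure hc hA

/-- The translation `τ_t` of the quasi-local algebra. -/
def translate (t : Site) : QLA →⋆ₐ[ℂ] QLA :=
  ((conjShift t).comp quasiLocal.subtype).codRestrict quasiLocal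
    (fun A => conjShift_mem t A.2)

/-! ### The Hamiltonian and the dynamics -/

/-- The stabilizer `K_f`, the tensor product of `σˣ` over the vertices of `f`. -/
def K (f : Face) : QLA := toQLA f.vertices (tensorPower f.vertices pauliX)

/-- The stabilizer `J_f`, the tensor product of `σᶻ` over the vertices of `f`. -/
def J (f : Face) : QLA := toQLA f.vertices (tensorPower f.vertices pauliZ)

/-- The faces all of whose vertices lie in `Λ`. -/
def facesIn (Λ : Finset Site) : Finset Face :=
  (Λ.subtype fun c => Even (c.1 + c.2)).filter fun f => f.vertices ⊆ Λ

theorem mem_facesIn {Λ : Finset Site} {f : Face} : f ∈ facesIn Λ ↔ f.vertices ⊆ Λ := by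
  simp only [facesIn, Finset.mem_filter, Finset.mem_subtype, and_iff_right_iff_imp]
  intro h
  exact h (by simp [Face.vertices])

/-- The Hamiltonian `H_Λ` of a finite region. -/
def hamiltonian (Λ : Finset Site) : QLA := -∑ f ∈ facesIn Λ, K f - ∑ f ∈ facesIn Λ, J f

/-- The generator of the dynamics, `δ(A) = lim_Λ i[H_Λ, A]` as `Λ` exhausts the lattice.
On local `A` the net is eventually constant (`generator_eq`). -/
def generator (A : QLA) : QLA :=
  Filter.limUnder Filter.atTop fun Λ : Finset Site =>
    Complex.I • (hamiltonian Λ * A - A * hamiltonian Λ)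

theorem localRep_commute {Λ₁ Λ₂ : Finset Site} (h : Disjoint Λ₁ Λ₂) (M : LocalMatrix Λ₁)
    (N : LocalMatrix Λ₂) : Commute (localRep Λ₁ M) (localRep Λ₂ N) := by
  have h12 : ∀ v, v ∈ Λ₁ → v ∉ Λ₂ := fun v h1 h2 => Finset.disjoint_left.1 h h1 h2
  have e1 : ∀ x s, restr Λ₁ (splice Λ₂ x s) = restr Λ₁ s := by
    intro x s; funext v; simp [restr, splice_apply, h12 v.1 v.2]
  have e2 : ∀ x s, restr Λ₂ (splice Λ₁ x s) = restr Λ₂ s := by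
    intro x s; funext v
    have : v.1 ∉ Λ₁ := fun h1 => h12 v.1 h1 v.2
    simp [restr, splice_apply, this]
  have e3 : ∀ x y s, splice Λ₁ x (splice Λ₂ y s) = splice Λ₂ y (splice Λ₁ x s) := by
    intro x y s; ext v
    by_cases h1 : v ∈ Λ₁
    · simp [splice_apply, h1, h12 v h1]
    · by_cases h2 : v ∈ Λ₂ <;> simp [splice_apply, h1, h2]
  change _ * _ = _ * _
  ext ψ s
  rw [mul_apply_eq_comp, mul_apply_eq_comp, localRep_apply,
    localRep_apply]
  simp only [localRep_apply, e1, e2, e3, Finset.mul_sum]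
  rw [Finset.sum_comm]
  refine Finset.sum_congr rfl fun y _ => Finset.sum_congr rfl fun x _ => ?_
  ring

/-- The union of `Λ` with all faces that meet it lies in this neighbourhood of `Λ`. -/
def thicken (Λ : Finset Site) : Finset Site :=
  Λ.biUnion fun v => Finset.Icc (v.1 - 2) (v.1 + 2) ×ˢ Finset.Icc (v.2 - 1) (v.2 + 1)

theorem vertices_subset_thicken {f : Face} {Λ : Finset Site} (h : ¬ Disjoint f.vertices Λ) :
    f.vertices ⊆ thicken Λ := by
  obtain ⟨v, hf, hv⟩ := Finset.not_disjoint_iff.1 h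
  intro w hw
  refine Finset.mem_biUnion.2 ⟨v, hv, ?_⟩
  simp only [Face.vertices, Finset.mem_insert, Finset.mem_singleton, Prod.ext_iff] at hf hw
  simp only [Finset.mem_product, Finset.mem_Icc]
  omega

theorem commutator_expand {R ι : Type*} [Ring R] (S : Finset ι) (k j : ι → R) (a : R) :
    (-∑ f ∈ S, k f - ∑ f ∈ S, j f) * a - a * (-∑ f ∈ S, k f - ∑ f ∈ S, j f)
      = -∑ f ∈ S, ((k f * a - a * k f) + (j f * a - a * j f)) := by
  simp only [sub_mul, mul_sub, neg_mul, mul_neg, Finset.sum_mul, Finset.mul_sum,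
    Finset.sum_add_distrib, Finset.sum_sub_distrib]
  abel

theorem toQLA_commutator_eq_zero {Λ Λ' : Finset Site} (hd : Disjoint Λ' Λ) (N : LocalMatrix Λ')
    {A : QLA} (hA : (A : Op) ∈ localAlgebra Λ) : toQLA Λ' N * A - A * toQLA Λ' N = 0 := by
  obtain ⟨M, hM⟩ := hA
  rw [sub_eq_zero]
  apply Subtype.ext
  change localRep Λ' N * (A : Op) = (A : Op) * localRep Λ' N
  rw [← hM]
  exact localRep_commute hd N M

/-- For `A` localized in `Λ`, the generator is the commutator with the Hamiltonian of any finite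
region that contains all faces meeting `Λ`. -/
theorem commutator_eq_of_thicken_subset {Λ Λ' : Finset Site} {A : QLA}
    (hA : (A : Op) ∈ localAlgebra Λ) (h : thicken Λ ⊆ Λ') :
    hamiltonian Λ' * A - A * hamiltonian Λ'
      = hamiltonian (thicken Λ) * A - A * hamiltonian (thicken Λ) := by
  have hsub : facesIn (thicken Λ) ⊆ facesIn Λ' := fun f hf =>
    mem_facesIn.2 ((mem_facesIn.1 hf).trans h)
  have hcomm : ∀ f ∈ facesIn Λ', f ∉ facesIn (thicken Λ) → K f * A - A * K f = 0 ∧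
      J f * A - A * J f = 0 := by
    intro f _ hf
    have hd : Disjoint f.vertices Λ := by
      by_contra hd
      exact hf (mem_facesIn.2 (vertices_subset_thicken hd))
    exact ⟨toQLA_commutator_eq_zero hd _ hA, toQLA_commutator_eq_zero hd _ hA⟩
  rw [hamiltonian, hamiltonian, commutator_expand (facesIn Λ') K J A,
    commutator_expand (facesIn (thicken Λ)) K J A]
  refine congrArg Neg.neg ?_
  symm
  refine Finset.sum_subset hsub fun f hf hf' => ?_
  rw [(hcomm f hf hf').1, (hcomm f hf hf').2, add_zero]

theorem generator_eq {Λ Λ' : Finset Site} {A : QLA} (hA : (A : Op) ∈ localAlgebra Λ)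
    (h : thicken Λ ⊆ Λ') :
    generator A = Complex.I • (hamiltonian Λ' * A - A * hamiltonian Λ') := by
  rw [commutator_eq_of_thicken_subset hA h]
  apply Filter.Tendsto.limUnder_eq
  refine tendsto_const_nhds.congr' ?_
  filter_upwards [Filter.eventually_ge_atTop (thicken Λ)] with Λ'' hΛ
  rw [commutator_eq_of_thicken_subset hA hΛ]

/-! ### States -/

/-- Positivity of a linear functional on the quasi-local algebra. -/
def IsPositive (φ : QLA →ₗ[ℂ] ℂ) : Prop := ∀ A : QLA, 0 ≤ φ (star A * A)

/-- A state: a positive linear functional that is normalized. -/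
def IsState (ω : QLA →ₗ[ℂ] ℂ) : Prop := IsPositive ω ∧ ω 1 = 1

/-- A pure state: a state such that every positive functional majorized by it is a multiple of
it. -/
def IsPureState (ω : QLA →ₗ[ℂ] ℂ) : Prop :=
  IsState ω ∧ ∀ φ : QLA →ₗ[ℂ] ℂ, IsPositive φ → IsPositive (ω - φ) → ∃ c : ℂ, φ = c • ω

/-- A ground state of the color code: a state with `-i ω(A* δ(A)) ≥ 0` for all local `A`. -/
def IsGroundState (ω : QLA →ₗ[ℂ] ℂ) : Prop :=
  IsState ω ∧ ∀ A : QLA, (A : Op) ∈ localObservables →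
    0 ≤ -Complex.I * ω (star A * generator A)

/-- Invariance under all translations of the lattice. -/
def IsTranslationInvariant (ω : QLA →ₗ[ℂ] ℂ) : Prop :=
  ∀ (t : LatticeTranslation) (A : QLA), ω (translate t.1 A) = ω A

end ColorCode

end

/-! Two faces always share an even number of vertices, so all `K f` and `J f` commute and can be
satisfied at once: the model is frustration free. Call a positive functional stabilized if it gives
every stabilizer its value at the unit. By Cauchy–Schwarz such a functional absorbs stabilizers on
either side (`map_mul_involution`).

Uniqueness: the products of a `σᶻ`-string and a `σˣ`-string span the local observables. If one of
the two strings overlaps some face oddly, the product anticommutes with a stabilizer and has value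
zero. Otherwise both supports are sums of faces modulo two, because the plane carries no finite
cycle other than such sums (`mem_faceSums`), and the product has the value of the unit. Density and
continuity then determine the functional up to its mass. Existence follows by compactness from code
vectors of finite sets of faces.

Purity and translation invariance are consequences of uniqueness: a functional majorized by the
stabilized state, and a translate of that state, are again stabilized. The ground state inequality
holds term by term.

Conversely, let `ω` be a ground state. For a finite set `F` of faces there are local operators `V i`
with `∑ i, star (V i) * V i = 1` that set all stabilizers of one type in `F` to one and disturb only
those of that type next to `F` (`exists_correction`). Testing the ground state condition on them
bounds the total defect `∑ f ∈ F, (1 - ω (stab b f))` by a boundary term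
(`IsGroundState.sum_defect_le`). Under translation invariance the defect is constant, so it grows
like the area of a rhombus while the bound grows like its perimeter; hence it vanishes. -/

namespace ColorCode

/-! ### Positive functionals on unital `*`-algebras -/

section PositiveFunctional

variable {A : Type*} [Ring A] [StarRing A] [Algebra ℂ A]

/-- The left kernel of a positive functional. -/
theorem map_mul_eq_zero_of_map_star_mul_self [StarModule ℂ A] {φ : A →ₗ[ℂ] ℂ}
    (hφ : ∀ a, 0 ≤ φ (star a * a)) {d : A} (hd : φ (star d * d) = 0) (b : A) :
    φ (b * d) = 0 ∧ φ (star d * star b) = 0 := by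
  -- The quadratic term in `t` drops out since `φ (star d * d) = 0`, and an expression real-affine
  -- in `t` that is never negative is constant. Real and imaginary `t` give the four real equations
  -- that kill both coefficients; that `φ` is hermitian is not presupposed.
  have key : ∀ t : ℂ, 0 ≤ φ (b * star b) + t * φ (b * d) + star t * φ (star d * star b) := by
    intro t
    have h := hφ (star b + t • d)
    have e : star (star b + t • d) * (star b + t • d)
        = b * star b + t • (b * d) + star t • (star d * star b) + (star t * t) • (star d * d) := by
      simp only [star_add, star_star, star_smul, mul_add, add_mul, mul_smul_comm, smul_mul_assoc]
      module
    rw [e] at h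
    simpa [hd] using h
  generalize φ (b * star b) = p at key
  generalize φ (b * d) = z at key ⊢
  generalize φ (star d * star b) = w at key ⊢
  have hre : ∀ r : ℝ, 0 ≤ p.re + r * (z.re + w.re) := fun r => by
    have := (Complex.le_def.1 (key r)).1
    simp at this
    linarith
  have him : ∀ r : ℝ, 0 ≤ p.re + r * (w.im - z.im) := fun r => by
    have := (Complex.le_def.1 (key (r * Complex.I))).1
    simp at this
    linarith
  have h0 := (Complex.le_def.1 (key 0)).2
  have h1 := (Complex.le_def.1 (key 1)).2
  have h2 := (Complex.le_def.1 (key Complex.I)).2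
  simp at h0 h1 h2
  have lin : ∀ q c : ℝ, (∀ r : ℝ, 0 ≤ q + r * c) → c = 0 := by
    intro q c h
    by_contra hc
    have := h (-(q + 1) / c)
    rw [div_mul_cancel₀ _ hc] at this
    linarith
  have e1 := lin _ _ hre
  have e2 := lin _ _ him
  constructor <;> apply Complex.ext <;> simp <;> linarith

theorem star_mul_self_of_involution {s : A} (hs : star s = s) (h2 : s * s = 1) :
    star (1 - s) * (1 - s) = (2 : ℂ) • (1 - s) := by
  simp only [star_sub, star_one, hs, mul_sub, sub_mul, mul_one, one_mul, h2]
  module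

/-- Since `1 - s` is twice a projection, `φ (1 - s) = 0` puts it in the left kernel of `φ`. -/
theorem map_mul_involution [StarModule ℂ A] {φ : A →ₗ[ℂ] ℂ} (hφ : ∀ a, 0 ≤ φ (star a * a))
    {s : A} (hs : star s = s) (h2 : s * s = 1) (h : φ s = φ 1) (b : A) :
    φ (b * s) = φ b ∧ φ (s * b) = φ b := by
  have hd : φ (star (1 - s) * (1 - s)) = 0 := by
    rw [star_mul_self_of_involution hs h2]
    simp [h]
  have h1 := (map_mul_eq_zero_of_map_star_mul_self hφ hd b).1
  have h3 := (map_mul_eq_zero_of_map_star_mul_self hφ hd (star b)).2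
  simp only [star_sub, star_one, hs, star_star, mul_sub, sub_mul, mul_one, one_mul, map_sub,
    sub_eq_zero] at h1 h3
  exact ⟨h1.symm, h3.symm⟩

/-- Positivity at `(1 - s) * b`, divided by two. This expresses `s ≤ 1` under compression by `b`. -/
theorem map_compression_involution_le {φ : A →ₗ[ℂ] ℂ} (hφ : ∀ a, 0 ≤ φ (star a * a))
    {s : A} (hs : star s = s) (h2 : s * s = 1) (b : A) :
    0 ≤ φ (star b * b) - φ (star b * (s * b)) := by
  have h := hφ ((1 - s) * b)
  rw [star_mul, mul_assoc, ← mul_assoc (star (1 - s)), star_mul_self_of_involution hs h2] at h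
  simp only [smul_mul_assoc, mul_smul_comm, map_smul, sub_mul, mul_sub, one_mul, map_sub,
    smul_eq_mul] at h
  have : (0 : ℂ) ≤ (2⁻¹ : ℂ) := by rw [Complex.le_def]; norm_num
  have h3 := mul_nonneg this h
  rwa [← mul_sub, inv_mul_cancel_left₀ two_ne_zero] at h3

end PositiveFunctional

/-- Positive functionals on a unital C*-algebra are continuous. -/
theorem continuous_of_positive {A : Type*} [CStarAlgebra A] {φ : A →ₗ[ℂ] ℂ}
    (hφ : ∀ a, 0 ≤ φ (star a * a)) : Continuous φ := by
  let _ := CStarAlgebra.spectralOrder A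
  let _ := CStarAlgebra.spectralOrderedRing A
  let ψ : A →ₚ[ℂ] ℂ := PositiveLinearMap.mk₀ φ (by
    intro a ha
    obtain ⟨b, rfl⟩ := CStarAlgebra.nonneg_iff_eq_star_mul_self.1 ha
    exact hφ b)
  obtain ⟨C, hC⟩ := ψ.exists_norm_apply_le
  exact AddMonoidHomClass.continuous_of_bound φ C hC

theorem IsPositive.continuous {φ : QLA →ₗ[ℂ] ℂ} (hφ : IsPositive φ) : Continuous φ := by
  have hc : IsClosed (quasiLocal : Set Op) := localObservables.isClosed_topologicalClosure
  let _ : CStarAlgebra QLA := StarSubalgebra.cstarAlgebra quasiLocal (h_closed := hc)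
  exact continuous_of_positive (A := QLA) hφ

/-! ### Pauli strings -/

/-- The sign of a spin. -/
def sgn (x : Fin 2) : ℂ := if x = 0 then 1 else -1

@[simp] theorem sgn_zero : sgn 0 = 1 := rfl

@[simp] theorem sgn_one : sgn 1 = -1 := rfl

theorem sgn_add (x y : Fin 2) : sgn (x + y) = sgn x * sgn y := by
  fin_cases x <;> fin_cases y <;> simp

theorem sgn_mul_self (x : Fin 2) : sgn x * sgn x = 1 := by
  fin_cases x <;> simp

/-- The parity of the overlap of two configurations, as a sign. -/
def chi (a s : Config) : ℂ := a.prod fun v x => sgn (x * s v)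

theorem chi_eq_prod {a : Config} {Λ : Finset Site} (h : a.support ⊆ Λ) (s : Config) :
    chi a s = ∏ v ∈ Λ, sgn (a v * s v) :=
  Finsupp.prod_of_support_subset a h _ (by simp)

theorem chi_comm (a s : Config) : chi a s = chi s a := by
  classical
  rw [chi_eq_prod (Finset.subset_union_left (s₂ := s.support)),
    chi_eq_prod (Finset.subset_union_right (s₁ := a.support))]
  simp only [mul_comm]

theorem chi_add_right (a s t : Config) : chi a (s + t) = chi a s * chi a t := by
  simp only [chi, Finsupp.prod, ← Finset.prod_mul_distrib]
  refine Finset.prod_congr rfl fun v _ => ?_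
  rw [← sgn_add, Finsupp.add_apply]
  congr 1
  generalize a v = x
  generalize s v = y
  generalize t v = z
  decide +revert

theorem chi_add_left (a b s : Config) : chi (a + b) s = chi a s * chi b s := by
  rw [chi_comm, chi_add_right, chi_comm s, chi_comm s]

@[simp] theorem chi_zero_left (s : Config) : chi 0 s = 1 := by simp [chi]

@[simp] theorem chi_zero_right (s : Config) : chi s 0 = 1 := by rw [chi_comm, chi_zero_left]

theorem chi_mul_self (a s : Config) : chi a s * chi a s = 1 := by
  simp only [chi, Finsupp.prod, ← Finset.prod_mul_distrib, sgn_mul_self, Finset.prod_const_one]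

theorem chi_eq_one_or (a s : Config) : chi a s = 1 ∨ chi a s = -1 :=
  mul_self_eq_one_iff.1 (chi_mul_self a s)

theorem fin_two_eq_one {x : Fin 2} (h : x ≠ 0) : x = 1 := by
  decide +revert

theorem fin_two_add_self (x : Fin 2) : x + x = 0 := by
  decide +revert

theorem config_add_self (a : Config) : a + a = 0 := by
  ext v
  simp [fin_two_add_self]

theorem config_neg (a : Config) : -a = a :=
  neg_eq_of_add_eq_zero_left (config_add_self a)

/-- The configuration with spins down exactly on `Λ`. -/
noncomputable def ind (Λ : Finset Site) : Config := Finsupp.indicator Λ fun _ _ => 1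

theorem ind_apply (Λ : Finset Site) (v : Site) : ind Λ v = if v ∈ Λ then 1 else 0 := by
  simp [ind, Finsupp.indicator_apply]

theorem support_ind (Λ : Finset Site) : (ind Λ).support = Λ := by
  ext v
  simp [ind_apply]

theorem ind_support (a : Config) : ind a.support = a := by
  ext v
  rw [ind_apply]
  by_cases h : a v = 0
  · simp [h]
  · simp [fin_two_eq_one h]

theorem chi_ind (Λ : Finset Site) (s : Config) : chi (ind Λ) s = ∏ v ∈ Λ, sgn (s v) := by
  rw [chi_eq_prod (support_ind Λ).subset]
  refine Finset.prod_congr rfl fun v hv => ?_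
  simp [ind_apply, hv]

theorem localRep_tensorPower_pauliX (Λ : Finset Site) (ψ : SpinSpace) (s : Config) :
    localRep Λ (tensorPower Λ pauliX) ψ s = ψ (s + ind Λ) := by
  classical
  have hX : ∀ x y : Fin 2, pauliX x y = if y = x + 1 then 1 else 0 := by
    intro x y
    fin_cases x <;> fin_cases y <;> simp [pauliX]
  rw [localRep_apply, Finset.sum_eq_single (fun v => restr Λ s v + 1)]
  · have h : splice Λ (fun v => restr Λ s v + 1) s = s + ind Λ := by
      ext v
      by_cases hv : v ∈ Λ <;> simp [splice_apply, ind_apply, restr, hv]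
    simp [tensorPower, hX, h]
  · intro y _ hy
    obtain ⟨v, hv⟩ := Function.ne_iff.1 hy
    have : tensorPower Λ pauliX (restr Λ s) y = 0 :=
      Finset.prod_eq_zero (Finset.mem_univ v) (by rw [hX, if_neg hv])
    rw [this, zero_mul]
  · simp

theorem localRep_tensorPower_pauliZ (Λ : Finset Site) (ψ : SpinSpace) (s : Config) :
    localRep Λ (tensorPower Λ pauliZ) ψ s = chi (ind Λ) s * ψ s := by
  classical
  have hZ : ∀ x y : Fin 2, pauliZ x y = if y = x then sgn x else 0 := by
    intro x y
    fin_cases x <;> fin_cases y <;> simp [pauliZ]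
  rw [localRep_apply, Finset.sum_eq_single (restr Λ s)]
  · rw [splice_restr, chi_ind, ← Finset.prod_coe_sort Λ (fun v => sgn (s v))]
    simp [tensorPower, hZ, restr]
  · intro y _ hy
    obtain ⟨v, hv⟩ := Function.ne_iff.1 hy
    have : tensorPower Λ pauliZ (restr Λ s) y = 0 :=
      Finset.prod_eq_zero (Finset.mem_univ v) (by rw [hZ, if_neg hv])
    rw [this, zero_mul]
  · simp

/-- The Pauli string over the support of `a`, of type `σˣ` or `σᶻ`. -/
noncomputable def pauli (b : Bool) (a : Config) : QLA :=
  toQLA a.support (tensorPower a.support (if b then pauliX else pauliZ))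

theorem pauli_true_apply (a : Config) (ψ : SpinSpace) (s : Config) :
    (pauli true a : Op) ψ s = ψ (s + a) := by
  have := localRep_tensorPower_pauliX a.support ψ s
  rwa [ind_support] at this

theorem pauli_false_apply (a : Config) (ψ : SpinSpace) (s : Config) :
    (pauli false a : Op) ψ s = chi a s * ψ s := by
  have := localRep_tensorPower_pauliZ a.support ψ s
  rwa [ind_support] at this

theorem pauli_mem_localAlgebra (b : Bool) (a : Config) :
    (pauli b a : Op) ∈ localAlgebra a.support := ⟨_, rfl⟩

theorem pauli_mem_localObservables (b : Bool) (a : Config) :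
    (pauli b a : Op) ∈ localObservables :=
  Set.mem_iUnion.2 ⟨_, pauli_mem_localAlgebra b a⟩

theorem pauli_mul (b : Bool) (a c : Config) : pauli b a * pauli b c = pauli b (a + c) := by
  apply Subtype.ext
  change (pauli b a : Op) * (pauli b c : Op) = _
  ext ψ s
  rw [mul_apply_eq_comp]
  cases b
  · simp only [pauli_false_apply, chi_add_left, mul_assoc]
  · simp only [pauli_true_apply, add_assoc]

@[simp] theorem pauli_zero (b : Bool) : pauli b 0 = 1 := by
  apply Subtype.ext
  change (pauli b 0 : Op) = 1
  ext ψ s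
  cases b
  · simp [pauli_false_apply]
  · simp [pauli_true_apply]

theorem pauli_mul_self (b : Bool) (a : Config) : pauli b a * pauli b a = 1 := by
  rw [pauli_mul, config_add_self, pauli_zero]

theorem star_pauli (b : Bool) (a : Config) : star (pauli b a) = pauli b a := by
  have h : star (tensorPower a.support (if b then pauliX else pauliZ))
      = tensorPower a.support (if b then pauliX else pauliZ) := by
    ext x y
    simp only [Matrix.star_apply, tensorPower, Matrix.of_apply, star_prod]
    refine Finset.prod_congr rfl fun v _ => ?_
    generalize x v = i
    generalize y v = j
    cases b <;> fin_cases i <;> fin_cases j <;> simp [pauliX, pauliZ]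
  apply Subtype.ext
  change star (localRep a.support _) = localRep a.support _
  rw [← map_star, h]

/-- Each site common to the two strings contributes one sign, and `chi` is the product of these
signs. -/
theorem pauli_anticomm (b : Bool) (a c : Config) :
    pauli b a * pauli (!b) c = chi a c • (pauli (!b) c * pauli b a) := by
  have h : ∀ a c, pauli true a * pauli false c = chi a c • (pauli false c * pauli true a) := by
    intro a c
    apply Subtype.ext
    change (pauli true a : Op) * (pauli false c : Op)
      = chi a c • ((pauli false c : Op) * (pauli true a : Op))
    ext ψ s
    rw [mul_apply_eq_comp, smul_apply, mul_apply_eq_comp, lp.coeFn_smul, Pi.smul_apply]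
    simp only [pauli_true_apply, pauli_false_apply, chi_add_right, smul_eq_mul, chi_comm a c]
    ring
  cases b
  · have := h c a
    change pauli false a * pauli true c = chi a c • (pauli true c * pauli false a)
    rw [this, smul_smul, chi_comm c a, chi_mul_self, one_smul]
  · exact h a c

/-- The indicator of a face. -/
noncomputable def faceCfg (f : Face) : Config := ind f.vertices

theorem K_eq_pauli (f : Face) : K f = pauli true (faceCfg f) := by
  apply Subtype.ext
  change localRep f.vertices _ = (pauli true (faceCfg f) : Op)
  ext ψ s
  rw [localRep_tensorPower_pauliX, pauli_true_apply, faceCfg]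

theorem J_eq_pauli (f : Face) : J f = pauli false (faceCfg f) := by
  apply Subtype.ext
  change localRep f.vertices _ = (pauli false (faceCfg f) : Op)
  ext ψ s
  rw [localRep_tensorPower_pauliZ, pauli_false_apply, faceCfg]

/-- The local observables are spanned by products of Pauli strings. -/
theorem localObservables_mem_span {A : QLA} (hA : (A : Op) ∈ localObservables) :
    A ∈ Submodule.span ℂ
      (Set.range fun p : Config × Config => pauli false p.1 * pauli true p.2) := by
  classical
  obtain ⟨Λ, M, hM⟩ := Set.mem_iUnion.1 hA
  -- The matrix unit `|x⟩⟨y|` is the flip of the spins where `x` and `y` differ, followed by the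
  -- projection `∏ v ∈ Λ, (1 + sgn (x v) σᶻ_v) / 2` onto `x`. The sum over `B` is this product
  -- expanded.
  have hunit : ∀ x y : Λ → Fin 2, (pull (unitPEquiv Λ x y) : Op)
      = ((∑ B ∈ Λ.powerset, ((2 : ℂ) ^ Λ.card)⁻¹ • chi (ind B) (splice Λ x 0) •
        (pauli false (ind B) * pauli true (splice Λ (x + y) 0)) : QLA) : Op) := by
    intro x y
    ext ψ s
    have e1 : ∀ B, ((((2 : ℂ) ^ Λ.card)⁻¹ • chi (ind B) (splice Λ x 0) •
        (pauli false (ind B) * pauli true (splice Λ (x + y) 0)) : QLA) : Op) ψ s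
        = ((2 : ℂ) ^ Λ.card)⁻¹ * ψ (s + splice Λ (x + y) 0)
          * ∏ v ∈ B, (sgn (splice Λ x 0 v) * sgn (s v)) := by
      intro B
      change ((2 : ℂ) ^ Λ.card)⁻¹ * (chi (ind B) (splice Λ x 0) *
        ((pauli false (ind B) : Op) * (pauli true (splice Λ (x + y) 0) : Op)) ψ s) = _
      rw [mul_apply_eq_comp, pauli_false_apply, pauli_true_apply, chi_ind, chi_ind,
        Finset.prod_mul_distrib]
      ring
    have e2 : ((∑ B ∈ Λ.powerset, ((2 : ℂ) ^ Λ.card)⁻¹ • chi (ind B) (splice Λ x 0) •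
        (pauli false (ind B) * pauli true (splice Λ (x + y) 0)) : QLA) : Op) ψ s
        = ((2 : ℂ) ^ Λ.card)⁻¹ * ψ (s + splice Λ (x + y) 0)
          * ∏ v ∈ Λ, (1 + sgn (splice Λ x 0 v) * sgn (s v)) := by
      rw [Finset.prod_one_add, Finset.mul_sum, ← Finset.sum_congr rfl fun B _ => e1 B]
      rw [AddSubmonoidClass.coe_finsetSum, sum_apply, lp.coeFn_sum, Finset.sum_apply]
    rw [e2, pull_apply]
    change Option.elim (if restr Λ s = x then some (splice Λ y s) else none) 0 ψ = _
    by_cases h : restr Λ s = x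
    · subst h
      have h1 : splice Λ y s = s + splice Λ (restr Λ s + y) 0 := by
        ext v
        by_cases hv : v ∈ Λ
        · simp [splice_apply, hv, restr, ← add_assoc, fin_two_add_self]
        · simp [splice_apply, hv]
      have h2 : ∏ v ∈ Λ, (1 + sgn (splice Λ (restr Λ s) 0 v) * sgn (s v)) = 2 ^ Λ.card := by
        rw [Finset.prod_congr rfl (g := fun _ => (2 : ℂ)), Finset.prod_const]
        intro v hv
        simp [splice_apply, hv, restr, sgn_mul_self]
        norm_num
      rw [if_pos rfl, h2, ← h1, mul_right_comm, inv_mul_cancel₀ (by simp), one_mul]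
      rfl
    · obtain ⟨v, hv⟩ := Function.ne_iff.1 h
      have h2 : ∏ v ∈ Λ, (1 + sgn (splice Λ x 0 v) * sgn (s v)) = 0 := by
        refine Finset.prod_eq_zero v.2 ?_
        have : restr Λ s v = s v := rfl
        rw [this] at hv
        simp only [splice_apply, v.2, dif_pos]
        generalize s v = i at hv ⊢
        generalize hj : x v = j at hv ⊢
        fin_cases i <;> fin_cases j <;> simp at hv ⊢
      rw [if_neg h, h2]
      simp
  have hU : ∀ x y : Λ → Fin 2, ∃ U ∈ Submodule.span ℂ
      (Set.range fun p : Config × Config => pauli false p.1 * pauli true p.2),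
      (U : Op) = pull (unitPEquiv Λ x y) := fun x y =>
    ⟨_, Submodule.sum_mem _ fun B _ => Submodule.smul_mem _ _ <| Submodule.smul_mem _ _ <|
      Submodule.subset_span ⟨(_, _), rfl⟩, (hunit x y).symm⟩
  choose U hUs hUp using hU
  have hA' : A = ∑ x, ∑ y, M x y • U x y := by
    apply Subtype.ext
    rw [← hM]
    change localOp Λ M = _
    simp only [localOp, ← hUp, AddSubmonoidClass.coe_finsetSum]
    rfl
  rw [hA']
  exact Submodule.sum_mem _ fun x _ => Submodule.sum_mem _ fun y _ =>
    Submodule.smul_mem _ _ (hUs x y)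

/-! ### Configurations that overlap evenly with every face -/

theorem mem_vertices {f : Face} {v : Site} :
    v ∈ f.vertices ↔ (f.1.1 ≤ v.1 ∧ v.1 ≤ f.1.1 + 2) ∧ (f.1.2 ≤ v.2 ∧ v.2 ≤ f.1.2 + 1) := by
  simp only [Face.vertices, Finset.mem_insert, Finset.mem_singleton, Prod.ext_iff]
  omega

theorem faceCfg_apply (f : Face) (v : Site) : faceCfg f v =
    if (f.1.1 ≤ v.1 ∧ v.1 ≤ f.1.1 + 2) ∧ (f.1.2 ≤ v.2 ∧ v.2 ≤ f.1.2 + 1) then 1 else 0 := by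
  simp only [faceCfg, ind_apply, mem_vertices]

theorem sgn_eq_one_iff {x : Fin 2} : sgn x = 1 ↔ x = 0 := by
  fin_cases x <;> norm_num [sgn]

/-- The overlap of `a` with the face with lower left corner `(i, j)`, modulo two. -/
def overlap (a : Config) (i j : ℤ) : Fin 2 :=
  a (i, j) + a (i + 1, j) + a (i + 2, j) + a (i, j + 1) + a (i + 1, j + 1) + a (i + 2, j + 1)

theorem overlap_add (a b : Config) (i j : ℤ) :
    overlap (a + b) i j = overlap a i j + overlap b i j := by
  simp only [overlap, Finsupp.add_apply]
  abel

theorem chi_faceCfg (f : Face) (a : Config) :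
    chi (faceCfg f) a = sgn (overlap a f.1.1 f.1.2) := by
  rw [faceCfg, chi_ind, Face.vertices]
  repeat rw [Finset.prod_insert (by
    simp only [Finset.mem_insert, Finset.mem_singleton, Prod.ext_iff]; omega)]
  simp only [Finset.prod_singleton, overlap, sgn_add, mul_assoc]

/-- Distinct faces share either no vertex or the two ends of an edge, and a face meets itself in six
vertices. Only finitely many relative positions `(p, q)` need checking. -/
theorem overlap_faceCfg (f : Face) {i j : ℤ} (h : Even (i + j)) : overlap (faceCfg f) i j = 0 := by
  have hf := f.2
  obtain ⟨p, hp⟩ : ∃ p, i = f.1.1 + p := ⟨i - f.1.1, by ring⟩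
  obtain ⟨q, hq⟩ : ∃ q, j = f.1.2 + q := ⟨j - f.1.2, by ring⟩
  simp only [overlap, faceCfg_apply]
  rw [Int.even_iff] at h hf
  by_cases hpq : (-2 ≤ p ∧ p ≤ 2) ∧ (-1 ≤ q ∧ q ≤ 1)
  · obtain ⟨⟨h1, h2⟩, h3, h4⟩ := hpq
    have hpar : (p + q) % 2 = 0 := by omega
    subst hp hq
    generalize f.1.1 = x
    generalize f.1.2 = y
    clear h hf
    interval_cases p <;> interval_cases q <;> simp at hpar <;> simp [add_assoc]
  · iterate 6 rw [if_neg (by omega)]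
    rfl

theorem chi_faceCfg_faceCfg (f g : Face) : chi (faceCfg f) (faceCfg g) = 1 := by
  rw [chi_faceCfg, overlap_faceCfg g f.2, sgn_zero]

/-- The configurations that are sums of faces. -/
noncomputable def faceSums : AddSubgroup Config := AddSubgroup.closure (Set.range faceCfg)

theorem faceCfg_mem_faceSums (f : Face) : faceCfg f ∈ faceSums :=
  AddSubgroup.subset_closure ⟨f, rfl⟩

/-- Any three consecutive sites of the row lie on one face, above or below the row according to
parity, so their values sum to zero. Finite support gives two consecutive zeros far to the right,
and the recurrence carries them to the left. -/
theorem eq_zero_of_single_row {a : Config} {l : ℤ} (hrow : ∀ v : Site, v.2 ≠ l → a v = 0)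
    (h : ∀ i j, Even (i + j) → overlap a i j = 0) : a = 0 := by
  have hrec : ∀ i, a (i, l) = a (i + 1, l) + a (i + 2, l) := by
    intro i
    have key : a (i, l) + a (i + 1, l) + a (i + 2, l) = 0 := by
      rcases Int.even_or_odd (i + l) with hp | hp
      · have := h i l hp
        rw [overlap, hrow (i, l + 1) (by simp), hrow (i + 1, l + 1) (by simp),
          hrow (i + 2, l + 1) (by simp)] at this
        simpa using this
      · have := h i (l - 1) (by rw [Int.even_iff]; rw [Int.odd_iff] at hp; omega)
        rw [overlap, hrow (i, l - 1) (by simp), hrow (i + 1, l - 1) (by simp),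
          hrow (i + 2, l - 1) (by simp)] at this
        simpa using this
    generalize a (i, l) = x at *
    generalize a (i + 1, l) = y at *
    generalize a (i + 2, l) = z at *
    decide +revert
  obtain ⟨N, hN⟩ : ∃ N : ℤ, ∀ i, N ≤ i → a (i, l) = 0 := by
    obtain ⟨N, hN⟩ := (a.support.image Prod.fst).bddAbove
    refine ⟨N + 1, fun i hi => ?_⟩
    by_contra hne
    have := hN (Finset.mem_coe.2 (Finset.mem_image_of_mem Prod.fst (Finsupp.mem_support_iff.2 hne)))
    simp at this
    omega
  have hdown : ∀ k : ℕ, a (N - k, l) = 0 ∧ a (N - k + 1, l) = 0 := by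
    intro k
    induction k with
    | zero => exact ⟨hN _ (by simp), hN _ (by simp)⟩
    | succ k ih =>
      have h1 := hrec (N - (k + 1 : ℕ))
      have e1 : N - ((k + 1 : ℕ) : ℤ) + 1 = N - k := by push_cast; ring
      have e2 : N - ((k + 1 : ℕ) : ℤ) + 2 = N - k + 1 := by push_cast; ring
      rw [e1, e2, ih.1, ih.2] at h1
      exact ⟨h1, e1 ▸ ih.1⟩
  ext ⟨i, j⟩
  by_cases hj : j = l
  · subst hj
    rcases le_total N i with hi | hi
    · rw [hN i hi]; rfl
    · have := (hdown (N - i).toNat).1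
      rw [Int.toNat_of_nonneg (by omega), sub_sub_cancel] at this
      rw [this]; rfl
  · rw [hrow _ hj]; rfl

/-- The sites of a row in the support of `a` at which a vertical edge leaves upwards. -/
def rowSites (a : Config) (m : ℤ) : Finset Site :=
  a.support.filter fun v => v.2 = m ∧ Even (v.1 + v.2)

theorem mem_rowSites {a : Config} {m : ℤ} {v : Site} :
    v ∈ rowSites a m ↔ a v ≠ 0 ∧ v.2 = m ∧ Even (v.1 + v.2) := by
  simp [rowSites]

/-- Peeling from the top, by induction on the height of the strip and then on the number of occupied
top sites with an edge upwards. Such a site is removed by adding the face below it. -/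
theorem mem_faceSums_of_rows (n : ℕ) (l : ℤ) : ∀ a : Config,
    (∀ v : Site, v.2 < l ∨ l + n < v.2 → a v = 0) →
    (∀ i j, Even (i + j) → overlap a i j = 0) → a ∈ faceSums := by
  induction n with
  | zero =>
    intro a hrow h
    rw [eq_zero_of_single_row (l := l) (fun v hv => hrow v (by simp; omega)) h]
    exact zero_mem _
  | succ n ih =>
    set m : ℤ := l + (n + 1 : ℕ) with hm
    have inner : ∀ k : ℕ, ∀ a : Config, (rowSites a m).card = k →
        (∀ v : Site, v.2 < l ∨ m < v.2 → a v = 0) →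
        (∀ i j, Even (i + j) → overlap a i j = 0) → a ∈ faceSums := by
      intro k
      induction k with
      | zero =>
        intro a hk hrow h
        rw [Finset.card_eq_zero] at hk
        have heven : ∀ i, Even (i + m) → a (i, m) = 0 := by
          intro i hi
          by_contra hne
          have : (i, m) ∈ rowSites a m := mem_rowSites.2 ⟨hne, rfl, hi⟩
          simp [hk] at this
        -- An odd site of the top row is the bottom middle vertex of a face whose other vertices are
        -- even sites of the row or lie above the strip.
        have htop : ∀ i, a (i, m) = 0 := by
          intro i
          rcases Int.even_or_odd (i + m) with hp | hp
          · exact heven i hp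
          · rw [Int.odd_iff] at hp
            have h1 := h (i - 1) m (by rw [Int.even_iff]; omega)
            rw [overlap, heven (i - 1) (by rw [Int.even_iff]; omega),
              heven (i - 1 + 2) (by rw [Int.even_iff]; omega), hrow (i - 1, m + 1) (by simp),
              hrow (i - 1 + 1, m + 1) (by simp), hrow (i - 1 + 2, m + 1) (by simp)] at h1
            simpa using h1
        refine ih a (fun v hv => ?_) h
        by_cases hvm : v.2 = m
        · rw [← htop v.1, ← hvm]
        · exact hrow v (by push_cast at hm; omega)
      | succ k ihk =>
        intro a hk hrow h
        obtain ⟨v, hv⟩ : (rowSites a m).Nonempty := by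
          rw [← Finset.card_pos]; omega
        obtain ⟨hav, hvm, hve⟩ := mem_rowSites.1 hv
        rw [Int.even_iff] at hve
        -- The face with `v` as top middle vertex. Its two other top vertices have odd parity and do
        -- not count in `rowSites`; its lower row still lies in the strip.
        let f : Face := ⟨(v.1 - 1, v.2 - 1), by rw [Int.even_iff]; simp only; omega⟩
        have hf1 : f.1.1 = v.1 - 1 := rfl
        have hf2 : f.1.2 = v.2 - 1 := rfl
        have hmem : a + faceCfg f ∈ faceSums := by
          refine ihk _ ?_ ?_ ?_
          · have : rowSites (a + faceCfg f) m = (rowSites a m).erase v := by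
              ext w
              rw [Finset.mem_erase, mem_rowSites, mem_rowSites, Finsupp.add_apply, faceCfg_apply,
                hf1, hf2]
              by_cases hw : w = v
              · subst hw
                rw [if_pos (by omega), fin_two_eq_one hav]
                simp
              · have : ¬ (w.1 = v.1 ∧ w.2 = v.2) := fun hc => hw (Prod.ext hc.1 hc.2)
                by_cases hwe : w.2 = m ∧ Even (w.1 + w.2)
                · have hwe2 := Int.even_iff.1 hwe.2
                  rw [if_neg (by omega)]
                  simp [hw]
                · simp [hwe]
            rw [this, Finset.card_erase_of_mem hv, hk, Nat.add_sub_cancel]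
          · intro w hw
            rw [Finsupp.add_apply, hrow w hw, faceCfg_apply, hf1, hf2, if_neg]
            · rfl
            · push_cast at hm; omega
          · intro i j hij
            rw [overlap_add, h i j hij, overlap_faceCfg f hij]
            rfl
        have := add_mem hmem (faceCfg_mem_faceSums f)
        rwa [add_assoc, config_add_self, add_zero] at this
    intro a hrow h
    exact inner _ a rfl hrow h

/-- A finite set of sites that overlaps evenly with every face is a sum of faces. -/
theorem mem_faceSums {a : Config} (h : ∀ f, chi (faceCfg f) a = 1) : a ∈ faceSums := by
  obtain ⟨u, hu⟩ := (a.support.image Prod.snd).bddAbove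
  obtain ⟨l, hl⟩ := (a.support.image Prod.snd).bddBelow
  refine mem_faceSums_of_rows (u - l).toNat l a (fun v hv => ?_) fun i j hij => ?_
  · by_contra hne
    have hmem : v.2 ∈ (↑(a.support.image Prod.snd) : Set ℤ) :=
      Finset.mem_coe.2 (Finset.mem_image_of_mem Prod.snd (Finsupp.mem_support_iff.2 hne))
    have h1 := hu hmem
    have h2 := hl hmem
    omega
  · have := h ⟨(i, j), hij⟩
    rwa [chi_faceCfg, sgn_eq_one_iff] at this

/-! ### Uniqueness of the frustration-free state -/

/-- The stabilizers, of type `σˣ` or `σᶻ`. -/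
noncomputable def stab (b : Bool) (f : Face) : QLA := pauli b (faceCfg f)

theorem K_eq_stab (f : Face) : K f = stab true f := K_eq_pauli f

theorem J_eq_stab (f : Face) : J f = stab false f := J_eq_pauli f

theorem star_stab (b : Bool) (f : Face) : star (stab b f) = stab b f := star_pauli _ _

theorem stab_mul_self (b : Bool) (f : Face) : stab b f * stab b f = 1 := pauli_mul_self _ _

/-- A functional on which each stabilizer acts as the identity. -/
def IsStabilized (φ : QLA →ₗ[ℂ] ℂ) : Prop := ∀ b f, φ (stab b f) = φ 1

theorem isStabilized_iff {φ : QLA →ₗ[ℂ] ℂ} :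
    IsStabilized φ ↔ ∀ f, φ (K f) = φ 1 ∧ φ (J f) = φ 1 := by
  simp only [K_eq_stab, J_eq_stab]
  exact ⟨fun h f => ⟨h true f, h false f⟩, fun h b f => by cases b; exacts [(h f).2, (h f).1]⟩

theorem IsStabilized.map_mul_stab {φ : QLA →ₗ[ℂ] ℂ} (hs : IsStabilized φ) (hφ : IsPositive φ)
    (b : Bool) (f : Face) (A : QLA) : φ (A * stab b f) = φ A :=
  (map_mul_involution hφ (star_stab b f) (stab_mul_self b f) (hs b f) A).1

theorem IsStabilized.map_stab_mul {φ : QLA →ₗ[ℂ] ℂ} (hs : IsStabilized φ) (hφ : IsPositive φ)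
    (b : Bool) (f : Face) (A : QLA) : φ (stab b f * A) = φ A :=
  (map_mul_involution hφ (star_stab b f) (stab_mul_self b f) (hs b f) A).2

theorem IsStabilized.map_pauli_mul {φ : QLA →ₗ[ℂ] ℂ} (hs : IsStabilized φ) (hφ : IsPositive φ)
    (b : Bool) {a : Config} (ha : a ∈ faceSums) :
    ∀ A, φ (pauli b a * A) = φ A := by
  induction ha using AddSubgroup.closure_induction with
  | mem x hx =>
    obtain ⟨f, rfl⟩ := hx
    exact hs.map_stab_mul hφ b f
  | zero => simp
  | add x y _ _ ihx ihy =>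
    intro A
    rw [← pauli_mul, mul_assoc, ihx, ihy]
  | neg x _ ih =>
    rwa [config_neg]

/-- Absorbing the stabilizer on the left and on the right gives `φ A = -φ A`. -/
theorem IsStabilized.map_eq_zero {φ : QLA →ₗ[ℂ] ℂ} (hs : IsStabilized φ) (hφ : IsPositive φ)
    {A : QLA} {b : Bool} {f : Face}
    (h : stab b f * A = -(A * stab b f)) : φ A = 0 := by
  have h1 := hs.map_stab_mul hφ b f A
  rw [h, map_neg, hs.map_mul_stab hφ] at h1
  exact self_eq_neg.1 h1.symm

open Classical in
theorem IsStabilized.map_pauli_mul_pauli {φ : QLA →ₗ[ℂ] ℂ} (hs : IsStabilized φ) (hφ : IsPositive φ)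
    (a c : Config) :
    φ (pauli false a * pauli true c) = if a ∈ faceSums ∧ c ∈ faceSums then φ 1 else 0 := by
  split_ifs with h
  · rw [hs.map_pauli_mul hφ _ h.1, ← mul_one (pauli true c), hs.map_pauli_mul hφ _ h.2]
  · rw [not_and_or] at h
    rcases h with h | h
    · obtain ⟨f, hf⟩ : ∃ f, chi (faceCfg f) a ≠ 1 := by
        by_contra! hc
        exact h (mem_faceSums hc)
      refine hs.map_eq_zero hφ (b := true) (f := f) ?_
      have h1 := pauli_anticomm true (faceCfg f) a
      rw [(chi_eq_one_or _ _).resolve_left hf, Bool.not_true] at h1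
      rw [stab, ← mul_assoc, h1, neg_one_smul, neg_mul, mul_assoc, mul_assoc, pauli_mul, pauli_mul,
        add_comm]
    · obtain ⟨f, hf⟩ : ∃ f, chi (faceCfg f) c ≠ 1 := by
        by_contra! hc
        exact h (mem_faceSums hc)
      refine hs.map_eq_zero hφ (b := false) (f := f) ?_
      have h1 := pauli_anticomm false (faceCfg f) c
      rw [(chi_eq_one_or _ _).resolve_left hf, Bool.not_false, neg_one_smul] at h1
      rw [stab, mul_assoc, ← neg_eq_iff_eq_neg.2 h1, mul_neg, neg_neg, ← mul_assoc, ← mul_assoc,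
        pauli_mul, pauli_mul, add_comm]

theorem dense_local : Dense {A : QLA | (A : Op) ∈ localObservables} := by
  intro A
  rw [Topology.IsInducing.subtypeVal.closure_eq_preimage_closure_image]
  have h : (localObservables : Set Op) ⊆
      Subtype.val '' {A : QLA | (A : Op) ∈ localObservables} := fun B hB =>
    ⟨⟨B, localObservables.le_topologicalClosure hB⟩, hB, rfl⟩
  exact closure_mono h A.2

/-- Two positive functionals of the same mass that are fixed by the stabilizers agree. -/
theorem IsStabilized.unique {φ φ' : QLA →ₗ[ℂ] ℂ} (hφ : IsPositive φ) (hs : IsStabilized φ)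
    (hφ' : IsPositive φ') (hs' : IsStabilized φ') (h1 : φ 1 = φ' 1) : φ = φ' := by
  have hspan : Set.EqOn φ φ' (Submodule.span ℂ
      (Set.range fun p : Config × Config => pauli false p.1 * pauli true p.2)) := by
    refine LinearMap.eqOn_span ?_
    rintro _ ⟨p, rfl⟩
    simp only
    rw [hs.map_pauli_mul_pauli hφ, hs'.map_pauli_mul_pauli hφ', h1]
  have := hφ.continuous.ext_on dense_local hφ'.continuous
    fun A hA => hspan (localObservables_mem_span hA)
  exact LinearMap.ext (congrFun this)

/-! ### Existence of the frustration-free state -/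

/-- The sums of faces taken from `F`. -/
noncomputable def partialSums (F : Finset Face) : Finset Config :=
  open Classical in F.powerset.image fun S => ∑ f ∈ S, faceCfg f

theorem zero_mem_partialSums (F : Finset Face) : 0 ∈ partialSums F := by
  classical
  exact Finset.mem_image.2 ⟨∅, by simp, by simp⟩

theorem add_mem_partialSums {F : Finset Face} {f : Face} (hf : f ∈ F) {s : Config}
    (hs : s ∈ partialSums F) : s + faceCfg f ∈ partialSums F := by
  classical
  obtain ⟨S, hS, rfl⟩ := Finset.mem_image.1 hs
  rw [Finset.mem_powerset] at hS
  by_cases h : f ∈ S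
  · refine Finset.mem_image.2 ⟨S.erase f,
      Finset.mem_powerset.2 ((Finset.erase_subset _ _).trans hS), ?_⟩
    rw [← Finset.sum_erase_add _ _ h, add_assoc, config_add_self, add_zero]
  · refine Finset.mem_image.2 ⟨insert f S, Finset.mem_powerset.2 (Finset.insert_subset hf hS), ?_⟩
    rw [Finset.sum_insert h, add_comm]

theorem add_mem_partialSums_iff {F : Finset Face} {f : Face} (hf : f ∈ F) (s : Config) :
    s + faceCfg f ∈ partialSums F ↔ s ∈ partialSums F := by
  refine ⟨fun h => ?_, add_mem_partialSums hf⟩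
  have := add_mem_partialSums hf h
  rwa [add_assoc, config_add_self, add_zero] at this

theorem chi_partialSums {F : Finset Face} (f : Face) {s : Config} (hs : s ∈ partialSums F) :
    chi (faceCfg f) s = 1 := by
  classical
  obtain ⟨S, -, rfl⟩ := Finset.mem_image.1 hs
  clear hs
  induction S using Finset.induction_on with
  | empty => simp
  | insert g S hg ih => rw [Finset.sum_insert hg, chi_add_right, ih, chi_faceCfg_faceCfg, mul_one]

/-- The superposition of the sums of faces taken from `F`. -/
noncomputable def codeVector (F : Finset Face) : SpinSpace :=
  ∑ s ∈ partialSums F, lp.single 2 s 1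

open Classical in
theorem codeVector_apply (F : Finset Face) (s : Config) :
    codeVector F s = if s ∈ partialSums F then 1 else 0 := by
  rw [codeVector, lp.coeFn_sum, Finset.sum_apply]
  simp [Pi.single_apply]

theorem codeVector_ne_zero (F : Finset Face) : codeVector F ≠ 0 := by
  classical
  intro h
  have := codeVector_apply F 0
  rw [h, if_pos (zero_mem_partialSums F)] at this
  simp at this

/-- The `σᶻ`-stabilizer sees only configurations that overlap `f` evenly; the `σˣ`-stabilizer
permutes `partialSums F`, all of whose members have the same coefficient. -/
theorem stab_codeVector {F : Finset Face} {f : Face} (hf : f ∈ F) (b : Bool) :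
    (stab b f : Op) (codeVector F) = codeVector F := by
  classical
  ext s
  cases b
  · rw [stab, pauli_false_apply, codeVector_apply]
    split_ifs with h
    · rw [chi_partialSums f h, one_mul]
    · rw [mul_zero]
  · rw [stab, pauli_true_apply, codeVector_apply, codeVector_apply,
      if_congr (add_mem_partialSums_iff hf s) rfl rfl]

/-- The expectation value of an observable in the normalized code vector. -/
noncomputable def expect (F : Finset Face) (A : QLA) : ℂ :=
  ((‖codeVector F‖ : ℂ) ^ 2)⁻¹ * inner ℂ (codeVector F) ((A : Op) (codeVector F))

theorem norm_codeVector_sq_ne_zero (F : Finset Face) : (‖codeVector F‖ : ℂ) ^ 2 ≠ 0 := by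
  simpa using codeVector_ne_zero F

theorem norm_expect_le (F : Finset Face) (A : QLA) : ‖expect F A‖ ≤ ‖A‖ := by
  have h0 : 0 < ‖codeVector F‖ := norm_pos_iff.2 (codeVector_ne_zero F)
  have h1 : ‖inner ℂ (codeVector F) ((A : Op) (codeVector F))‖ ≤ ‖A‖ * ‖codeVector F‖ ^ 2 :=
    calc _ ≤ ‖codeVector F‖ * ‖(A : Op) (codeVector F)‖ := norm_inner_le_norm _ _
      _ ≤ ‖codeVector F‖ * (‖A‖ * ‖codeVector F‖) := by
        gcongr
        exact (A : Op).le_opNorm _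
      _ = _ := by ring
  rw [expect, norm_mul, norm_inv, norm_pow, Complex.norm_real, norm_norm,
    inv_mul_le_iff₀ (by positivity)]
  linarith

theorem expect_star_mul_self_nonneg (F : Finset Face) (A : QLA) : 0 ≤ expect F (star A * A) := by
  have h : inner ℂ (codeVector F) (((star A * A : QLA) : Op) (codeVector F))
      = ((‖(A : Op) (codeVector F)‖ : ℂ)) ^ 2 := by
    change inner ℂ (codeVector F) ((star (A : Op) * (A : Op)) (codeVector F)) = _
    rw [mul_apply_eq_comp, ContinuousLinearMap.star_eq_adjoint,
      ContinuousLinearMap.adjoint_inner_right, inner_self_eq_norm_sq_to_K]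
    rfl
  rw [expect, h]
  norm_cast
  positivity

theorem expect_one (F : Finset Face) : expect F 1 = 1 := by
  change ((‖codeVector F‖ : ℂ) ^ 2)⁻¹ * inner ℂ (codeVector F) (codeVector F) = 1
  rw [inner_self_eq_norm_sq_to_K]
  exact inv_mul_cancel₀ (norm_codeVector_sq_ne_zero F)

theorem expect_stab {F : Finset Face} {f : Face} (hf : f ∈ F) (b : Bool) :
    expect F (stab b f) = 1 := by
  rw [expect, stab_codeVector hf, inner_self_eq_norm_sq_to_K]
  exact inv_mul_cancel₀ (norm_codeVector_sq_ne_zero F)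

theorem expect_add (F : Finset Face) (A B : QLA) : expect F (A + B) = expect F A + expect F B := by
  rw [expect, expect, expect, ← mul_add, ← inner_add_right]
  rfl

theorem expect_smul (F : Finset Face) (c : ℂ) (A : QLA) : expect F (c • A) = c * expect F A := by
  rw [expect, expect, mul_left_comm]
  exact congrArg _ (inner_smul_right _ _ c)

/-- The limit of the code vector states along an ultrafilter finer than `atTop`. It exists because
`expect F A` stays in the disc of radius `‖A‖`, and each stabilizer has expectation one as soon as
its face belongs to `F`. -/
theorem exists_stabilized_state : ∃ ω : QLA →ₗ[ℂ] ℂ, IsState ω ∧ IsStabilized ω := by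
  classical
  let U : Ultrafilter (Finset Face) := Ultrafilter.of Filter.atTop
  have hU : (U : Filter (Finset Face)) ≤ Filter.atTop := Ultrafilter.of_le _
  have hlim : ∀ A : QLA, ∃ z, Filter.Tendsto (fun F => expect F A) U (nhds z) := by
    intro A
    obtain ⟨z, -, hz⟩ := (isCompact_closedBall (0 : ℂ) ‖A‖).ultrafilter_le_nhds
      (U.map fun F => expect F A) (by
        rw [Ultrafilter.coe_map, Filter.le_principal_iff, Filter.mem_map]
        exact Filter.univ_mem' fun F => by simpa using norm_expect_le F A)
    exact ⟨z, hz⟩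
  choose ω hω using hlim
  let ω₀ : QLA →ₗ[ℂ] ℂ :=
    { toFun := ω
      map_add' := fun A B => tendsto_nhds_unique (hω (A + B)) (by
        simpa only [expect_add] using (hω A).add (hω B))
      map_smul' := fun c A => tendsto_nhds_unique (hω (c • A)) (by
        simpa only [expect_smul, RingHom.id_apply, smul_eq_mul] using (hω A).const_mul c) }
  have h1 : ω₀ 1 = 1 := tendsto_nhds_unique (hω 1) (by
    simp only [expect_one]
    exact tendsto_const_nhds)
  refine ⟨ω₀, ⟨fun A => ge_of_tendsto' (hω (star A * A)) fun F =>
    expect_star_mul_self_nonneg F A, h1⟩, fun b f => ?_⟩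
  rw [h1]
  refine tendsto_nhds_unique (hω (stab b f)) (tendsto_const_nhds.congr' ?_)
  filter_upwards [hU (Filter.eventually_ge_atTop {f})] with F hF
  exact (expect_stab (Finset.singleton_subset_iff.1 hF) b).symm

/-! ### Properties of the frustration-free state -/

/-- Both `φ` and `ω - φ` are nonnegative on `1 - stab b f`, and their sum vanishes there. So `φ` is
stabilized with mass `φ 1`, as is `φ 1 • ω`. -/
theorem IsStabilized.isPureState {ω : QLA →ₗ[ℂ] ℂ} (hω : IsState ω) (hs : IsStabilized ω) :
    IsPureState ω := by
  refine ⟨hω, fun φ hφ hωφ => ⟨φ 1, ?_⟩⟩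
  have h1 : 0 ≤ φ 1 := by simpa using hφ 1
  refine IsStabilized.unique hφ (fun b f => ?_) (fun A => ?_) (fun b f => ?_) ?_
  · have h2 := map_compression_involution_le hφ (star_stab b f) (stab_mul_self b f) 1
    have h3 := map_compression_involution_le hωφ (star_stab b f) (stab_mul_self b f) 1
    simp only [star_one, one_mul, mul_one, LinearMap.sub_apply, hs b f, sub_sub_sub_cancel_left]
      at h2 h3
    exact le_antisymm (sub_nonneg.1 h2) (sub_nonneg.1 h3)
  · exact mul_nonneg h1 (hω.1 A)
  · simp [hs b f]
  · simp [hω.2]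

/-- The set `F` can be taken to contain any prescribed `G`, since further faces contribute nothing
to the commutator. -/
theorem generator_eq_sum {A : QLA} (hA : (A : Op) ∈ localObservables) (G : Finset Face) :
    ∃ F : Finset Face, G ⊆ F ∧ ∀ b, generator A = Complex.I •
      -∑ f ∈ F, ((stab b f * A - A * stab b f) + (stab (!b) f * A - A * stab (!b) f)) := by
  classical
  obtain ⟨Λ, hΛ⟩ := Set.mem_iUnion.1 hA
  refine ⟨facesIn (thicken Λ ∪ G.biUnion Face.vertices), fun f hf => ?_, fun b => ?_⟩
  · exact mem_facesIn.2 ((Finset.subset_biUnion_of_mem Face.vertices hf).trans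
      Finset.subset_union_right)
  · rw [generator_eq hΛ (Finset.subset_union_left (s₂ := G.biUnion Face.vertices)), hamiltonian,
      commutator_expand]
    simp only [K_eq_stab, J_eq_stab]
    cases b
    · simp only [Bool.not_false, add_comm (stab false _ * _ - _)]
    · simp only [Bool.not_true]

/-- Absorbing the stabilizer `S` on the right turns each term `-ω (star A * (S * A - A * S))` into
`ω (star A * A) - ω (star A * (S * A))`, which is nonnegative because `S ≤ 1`. -/
theorem IsStabilized.isGroundState {ω : QLA →ₗ[ℂ] ℂ} (hω : IsState ω) (hs : IsStabilized ω) :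
    IsGroundState ω := by
  refine ⟨hω, fun A hA => ?_⟩
  obtain ⟨F, -, hF⟩ := generator_eq_sum hA ∅
  have hterm : ∀ b f, 0 ≤ -ω (star A * (stab b f * A - A * stab b f)) := by
    intro b f
    have := map_compression_involution_le hω.1 (star_stab b f) (stab_mul_self b f) A
    rwa [mul_sub, map_sub, ← mul_assoc (star A) A, hs.map_mul_stab hω.1, neg_sub]
  rw [hF true, mul_smul_comm, map_smul, smul_eq_mul, ← mul_assoc, neg_mul, Complex.I_mul_I,
    neg_neg, one_mul, mul_neg, map_neg, Finset.mul_sum, map_sum, ← Finset.sum_neg_distrib]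
  refine Finset.sum_nonneg fun f _ => ?_
  rw [mul_add, map_add, neg_add]
  exact add_nonneg (hterm _ f) (hterm _ f)

/-! ### Translation covariance of the stabilizers -/

theorem translate_tensorPower (t : Site) (Λ : Finset Site) (σ : Matrix (Fin 2) (Fin 2) ℂ) :
    translate t (toQLA Λ (tensorPower Λ σ))
      = toQLA (translateRegion t Λ) (tensorPower (translateRegion t Λ) σ) := by
  apply Subtype.ext
  change conjShift t (localRep Λ _) = localRep _ _
  rw [conjShift_localRep]
  congr 1
  ext x y
  simp only [Matrix.submatrix_apply, tensorPower, Matrix.of_apply]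
  let e : Λ ≃ translateRegion t Λ :=
    { toFun := fun v => ⟨v.1 + t, mem_translateRegion v.2⟩
      invFun := fun v => ⟨v.1 - t, sub_mem_of_mem_translateRegion v.2⟩
      left_inv := fun v => by simp
      right_inv := fun v => by simp }
  exact Fintype.prod_equiv e _ _ fun v => rfl

/-- The translate of a face. -/
def translateFace (t : LatticeTranslation) (f : Face) : Face :=
  ⟨f.1 + t.1, by
    rw [Prod.fst_add, Prod.snd_add, add_add_add_comm]
    exact f.2.add t.2⟩

theorem translateRegion_vertices (t : LatticeTranslation) (f : Face) :
    translateRegion t.1 f.vertices = (translateFace t f).vertices := by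
  ext v
  constructor
  · intro hv
    have := mem_vertices.1 (sub_mem_of_mem_translateRegion hv)
    rw [mem_vertices]
    simp [translateFace] at this ⊢
    omega
  · intro hv
    rw [← sub_add_cancel v t.1]
    apply mem_translateRegion
    rw [mem_vertices] at hv ⊢
    simp [translateFace] at hv ⊢
    omega

theorem translate_stab (t : LatticeTranslation) (b : Bool) (f : Face) :
    translate t.1 (stab b f) = stab b (translateFace t f) := by
  cases b
  · rw [← J_eq_stab, ← J_eq_stab, J, J, translate_tensorPower,
      translateRegion_vertices]
  · rw [← K_eq_stab, ← K_eq_stab, K, K, translate_tensorPower,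
      translateRegion_vertices]

theorem IsStabilized.isTranslationInvariant {ω : QLA →ₗ[ℂ] ℂ} (hω : IsState ω)
    (hs : IsStabilized ω) : IsTranslationInvariant ω := by
  intro t A
  let φ : QLA →ₗ[ℂ] ℂ := ω ∘ₗ (translate t.1).toAlgHom.toLinearMap
  have hφ : ∀ A, φ A = ω (translate t.1 A) := fun _ => rfl
  have : φ = ω := by
    refine IsStabilized.unique (fun A => ?_) (fun b f => ?_) hω.1 hs ?_
    · rw [hφ, map_mul, map_star]
      exact hω.1 _
    · rw [hφ, hφ, translate_stab, map_one, hs]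
    · rw [hφ, map_one]
  rw [← hφ, this]

/-! ### Correcting the stabilizers inside a finite region -/

/-- The top middle vertex of a face; the other faces that contain it lie one row higher. -/
def topMid (f : Face) : Site := (f.1.1 + 1, f.1.2 + 1)

/-- The Pauli matrix at the top middle vertex of `f` that flips the stabilizer of `f`. -/
noncomputable def flip (b : Bool) (f : Face) : QLA := pauli (!b) (ind {topMid f})

theorem chi_topMid (f g : Face) :
    chi (faceCfg g) (ind {topMid f}) = if topMid f ∈ g.vertices then -1 else 1 := by
  rw [chi_comm, chi_ind, Finset.prod_singleton, faceCfg, ind_apply]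
  split_ifs <;> simp

theorem topMid_mem (f : Face) : topMid f ∈ f.vertices := by
  rw [mem_vertices]
  simp [topMid]

theorem stab_mul_flip (b : Bool) (f : Face) : stab b f * flip b f = -(flip b f * stab b f) := by
  rw [stab, flip, pauli_anticomm, chi_topMid, if_pos (topMid_mem f), neg_one_smul]

theorem commute_stab_flip (b : Bool) {f g : Face} (h : topMid f ∉ g.vertices) :
    Commute (stab b g) (flip b f) := by
  rw [commute_iff_eq, stab, flip, pauli_anticomm, chi_topMid, if_neg h, one_smul]

theorem commute_pauli (b : Bool) (a c : Config) : Commute (pauli b a) (pauli b c) := by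
  rw [commute_iff_eq, pauli_mul, pauli_mul, add_comm]

theorem commute_stab_not_stab (b : Bool) (f g : Face) : Commute (stab (!b) g) (stab b f) := by
  rw [commute_iff_eq]
  have := pauli_anticomm b (faceCfg f) (faceCfg g)
  rw [chi_faceCfg_faceCfg, one_smul] at this
  exact this.symm

/-- The operators that measure the stabilizer of `f` and flip it to `1` if needed. -/
noncomputable def correction (b : Bool) (f : Face) (c : Bool) : QLA :=
  if c then (2⁻¹ : ℂ) • (1 + stab b f) else (2⁻¹ : ℂ) • (flip b f * (1 - stab b f))

theorem mem_local_smul {A : QLA} (c : ℂ) (hA : (A : Op) ∈ localObservables) :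
    ((c • A : QLA) : Op) ∈ localObservables :=
  SMulMemClass.smul_mem c hA

theorem mem_local_mul {A B : QLA} (hA : (A : Op) ∈ localObservables)
    (hB : (B : Op) ∈ localObservables) : ((A * B : QLA) : Op) ∈ localObservables :=
  mul_mem hA hB

theorem correction_mem_local (b : Bool) (f : Face) (c : Bool) :
    (correction b f c : Op) ∈ localObservables := by
  have hS : (stab b f : Op) ∈ localObservables := pauli_mem_localObservables _ _
  have hW : (flip b f : Op) ∈ localObservables := pauli_mem_localObservables _ _
  cases c
  · exact mem_local_smul (A := flip b f * (1 - stab b f)) _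
      (mem_local_mul hW (B := 1 - stab b f) (sub_mem (one_mem _) hS))
  · exact mem_local_smul (A := 1 + stab b f) _ (add_mem (one_mem _) hS)

/-- The two operators are partial isometries with initial projections `(1 + S) / 2` and `(1 - S) /
2`, where `S` is the stabilizer of `f`. -/
theorem sum_star_correction_mul (b : Bool) (f : Face) :
    ∑ c, star (correction b f c) * correction b f c = 1 := by
  have hS := star_stab b f
  have hSS := stab_mul_self b f
  have hW : star (flip b f) = flip b f := star_pauli _ _
  have hWW : flip b f * flip b f = 1 := pauli_mul_self _ _
  have h2 : star (2⁻¹ : ℂ) = 2⁻¹ := by simp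
  have h1 : star (flip b f * (1 - stab b f)) * (flip b f * (1 - stab b f))
      = (2 : ℂ) • (1 - stab b f) := by
    rw [star_mul, hW, mul_assoc, ← mul_assoc (flip b f), hWW, one_mul,
      star_mul_self_of_involution hS hSS]
  have h3 : star (1 + stab b f) * (1 + stab b f) = (2 : ℂ) • (1 + stab b f) := by
    simp only [star_add, star_one, hS, mul_add, add_mul, mul_one, one_mul, hSS]
    module
  rw [Fintype.sum_bool]
  simp only [correction, if_true, Bool.false_eq_true, if_false, star_smul, h2, smul_mul_smul_comm,
    h1, h3]
  module

theorem stab_mul_correction (b : Bool) (f : Face) (c : Bool) :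
    stab b f * correction b f c = correction b f c := by
  have hSS := stab_mul_self b f
  cases c
  · simp only [correction, Bool.false_eq_true, if_false, mul_smul_comm]
    rw [← mul_assoc, stab_mul_flip, neg_mul, mul_assoc, mul_sub, mul_one, hSS, ← mul_neg, neg_sub]
  · simp only [correction, if_true, mul_smul_comm]
    rw [mul_add, mul_one, hSS, add_comm]

theorem commute_correction {A : QLA} {b : Bool} {f : Face} (h1 : Commute A (stab b f))
    (h2 : Commute A (flip b f)) (c : Bool) : Commute A (correction b f c) := by
  cases c
  · exact (h2.mul_right ((Commute.one_right A).sub_right h1)).smul_right _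
  · exact ((Commute.one_right A).add_right h1).smul_right _

/-- A family of local operators that implements the correction of all stabilizers of one type in
a finite set of faces. -/
theorem exists_correction (b : Bool) (F : Finset Face) : ∃ (ι : Type) (_ : Fintype ι)
    (V : ι → QLA), (∀ i, (V i : Op) ∈ localObservables) ∧ ∑ i, star (V i) * V i = 1 ∧
      (∀ f ∈ F, ∀ i, stab b f * V i = V i) ∧
      (∀ g, (∀ f ∈ F, topMid f ∉ g.vertices) → ∀ i, Commute (stab b g) (V i)) ∧
      ∀ g i, Commute (stab (!b) g) (V i) := by
  classical
  -- Faces are corrected from the bottom row upwards. A flip at `topMid f` affects only `f` and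
  -- faces one row higher, so it preserves the stabilizers already corrected.
  induction F using Finset.induction_on_max_value (fun f : Face => f.1.2) with
  | empty =>
    exact ⟨Unit, inferInstance, fun _ => 1, fun _ => one_mem _, by simp, by simp,
      fun _ _ _ => Commute.one_right _, fun _ _ => Commute.one_right _⟩
  | insert f F hf hmax ih =>
    obtain ⟨ι, _, V, hloc, hsum, hfix, hcomm, hcomm'⟩ := ih
    refine ⟨ι × Bool, inferInstance, fun p => correction b f p.2 * V p.1,
      fun p => mem_local_mul (correction_mem_local b f p.2) (hloc p.1), ?_, ?_, ?_, ?_⟩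
    · rw [Fintype.sum_prod_type, ← hsum]
      refine Finset.sum_congr rfl fun i _ => ?_
      have : ∀ c, star (correction b f c * V i) * (correction b f c * V i)
          = star (V i) * (star (correction b f c) * correction b f c * V i) := fun c => by
        rw [star_mul]; simp only [mul_assoc]
      simp only [this]
      rw [← Finset.mul_sum, ← Finset.sum_mul, sum_star_correction_mul, one_mul]
    · intro g hg p
      rcases Finset.mem_insert.1 hg with rfl | hg
      · rw [← mul_assoc, stab_mul_correction]
      · have hnot : topMid f ∉ g.vertices := by
          intro hmem
          have h1 := hmax g hg
          have h2 := f.2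
          have h3 := g.2
          have h4 : ¬ (g.1.1 = f.1.1 ∧ g.1.2 = f.1.2) := fun h =>
            hf ((Subtype.ext (Prod.ext h.1 h.2) : g = f) ▸ hg)
          rw [mem_vertices, topMid] at hmem
          rw [Int.even_iff] at h2 h3
          simp only at hmem h1
          omega
        have hc : Commute (stab b g) (correction b f p.2) :=
          commute_correction (commute_pauli b _ _) (commute_stab_flip b hnot) p.2
        rw [← mul_assoc, hc.eq, mul_assoc, hfix g hg]
    · intro g hg p
      exact (commute_correction (commute_pauli b _ _)
        (commute_stab_flip b (hg f (Finset.mem_insert_self f F))) p.2).mul_right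
        (hcomm g (fun f' hf' => hg f' (Finset.mem_insert_of_mem hf')) p.1)
    · intro g p
      exact (commute_correction (commute_stab_not_stab b f g)
        (commute_pauli (!b) _ _) p.2).mul_right (hcomm' g p.1)

/-! ### Translation invariant ground states -/

theorem IsState.map_stab_le_one {ω : QLA →ₗ[ℂ] ℂ} (hω : IsState ω) (b : Bool) (f : Face) :
    ω (stab b f) ≤ 1 := by
  have := map_compression_involution_le hω.1 (star_stab b f) (stab_mul_self b f) 1
  simpa [hω.2] using this

/-- The energy that the correction gains inside `F` is at most what it costs outside. -/
theorem IsGroundState.sum_defect_le {ω : QLA →ₗ[ℂ] ℂ} (hω : IsGroundState ω) (b : Bool)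
    {F G : Finset Face} (hFG : F ⊆ G) (hG : ∀ f ∈ F, ∀ g, topMid f ∈ g.vertices → g ∈ G) :
    ∑ f ∈ F, (1 - ω (stab b f)) ≤ 2 * ((G.card : ℂ) - F.card) := by
  classical
  obtain ⟨ι, _, V, hloc, hsum, hfix, hcomm, hcomm'⟩ := exists_correction b F
  have hmass : ∀ A, ∑ i, ω (star (V i) * V i * A) = ω A := fun A => by
    rw [← map_sum, ← Finset.sum_mul, hsum, one_mul]
  have hone : ∑ i, ω (star (V i) * V i) = 1 := by rw [← map_sum, hsum, hω.1.2]
  -- The ground state condition at `V i`: stabilizers of the other type and those outside `G`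
  -- commute with `V i` and drop out.
  have hi : ∀ i, ∑ f ∈ G, ω (star (V i) * (stab b f * V i - V i * stab b f)) ≤ 0 := by
    intro i
    obtain ⟨F', hF', hgen⟩ := generator_eq_sum (hloc i) G
    have h := hω.2 (V i) (hloc i)
    rw [hgen b, mul_smul_comm, map_smul, smul_eq_mul, ← mul_assoc, neg_mul, Complex.I_mul_I,
      neg_neg, one_mul, mul_neg, map_neg, Finset.mul_sum, map_sum, neg_nonneg] at h
    have e1 : ∀ f, stab (!b) f * V i - V i * stab (!b) f = 0 := fun f =>
      sub_eq_zero.2 (hcomm' f i).eq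
    simp only [e1, add_zero] at h
    rwa [Finset.sum_subset hF']
    intro g _ hg
    rw [sub_eq_zero.2 (hcomm g (fun f hf hmem => hg (hG f hf g hmem)) i).eq, mul_zero, map_zero]
  have htot : ∑ f ∈ G, ∑ i, ω (star (V i) * (stab b f * V i - V i * stab b f)) ≤ 0 := by
    rw [Finset.sum_comm]
    exact Finset.sum_nonpos fun i _ => hi i
  -- Summed over `i`, the commutator term is the change in the expectation of the stabilizer caused
  -- by the correction.
  have hE : ∀ f, ∑ i, ω (star (V i) * (stab b f * V i - V i * stab b f))
      = ∑ i, ω (star (V i) * (stab b f * V i)) - ω (stab b f) := by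
    intro f
    simp only [mul_sub, map_sub, Finset.sum_sub_distrib, ← mul_assoc (star _) (V _) (stab b f),
      hmass]
  have hin : ∑ f ∈ F, ∑ i, ω (star (V i) * (stab b f * V i - V i * stab b f))
      = ∑ f ∈ F, (1 - ω (stab b f)) := by
    refine Finset.sum_congr rfl fun f hf => ?_
    rw [hE]
    simp only [hfix f hf, hone]
  -- An expectation outside `F` falls by at most two: it was at most one and is at least minus one
  -- after the correction.
  have hout : ∑ f ∈ G \ F, ((-2 : ℤ) : ℂ) ≤
      ∑ f ∈ G \ F, ∑ i, ω (star (V i) * (stab b f * V i - V i * stab b f)) := by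
    refine Finset.sum_le_sum fun f _ => ?_
    rw [hE]
    have h1 := hω.1.map_stab_le_one b f
    have h2 : 0 ≤ ∑ i, (ω (star (V i) * V i) + ω (star (V i) * (stab b f * V i))) := by
      refine Finset.sum_nonneg fun i _ => ?_
      have := map_compression_involution_le hω.1.1 (s := -stab b f)
        (by rw [star_neg, star_stab]) (by rw [neg_mul_neg, stab_mul_self]) (V i)
      simpa using this
    rw [Finset.sum_add_distrib, hone] at h2
    have h3 := add_nonneg h2 (sub_nonneg.2 h1)
    rw [← sub_nonneg]
    convert h3 using 1
    push_cast
    ring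
  rw [← Finset.sum_sdiff hFG, hin] at htot
  rw [Finset.sum_const, Finset.card_sdiff_of_subset hFG, nsmul_eq_mul,
    Nat.cast_sub (Finset.card_le_card hFG)] at hout
  have h4 := add_nonneg (sub_nonneg.2 htot) (sub_nonneg.2 hout)
  rw [← sub_nonneg]
  convert h4 using 1
  push_cast
  ring

/-- The faces of the lattice in the coordinates given by the translations `(1, 1)` and
`(-1, 1)`. -/
def gridFace (p : ℕ × ℕ) : Face :=
  ⟨((p.1 : ℤ) - p.2, (p.1 : ℤ) + p.2), by rw [Int.even_iff]; simp only; omega⟩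

theorem gridFace_injective : Function.Injective gridFace := by
  intro p q h
  have h1 : (p.1 : ℤ) - p.2 = q.1 - q.2 := congrArg (fun f : Face => f.1.1) h
  have h2 : (p.1 : ℤ) + p.2 = q.1 + q.2 := congrArg (fun f : Face => f.1.2) h
  exact Prod.ext (by omega) (by omega)

/-- A rhombus of `n²` faces. -/
def rhombus (n : ℕ) : Finset Face :=
  (Finset.range n ×ˢ Finset.range n).map ⟨gridFace, gridFace_injective⟩

theorem mem_rhombus {n : ℕ} {f : Face} :
    f ∈ rhombus n ↔ ∃ p q : ℕ, p < n ∧ q < n ∧ f.1.1 = (p : ℤ) - q ∧ f.1.2 = (p : ℤ) + q := by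
  simp only [rhombus, Finset.mem_map, Finset.mem_product, Finset.mem_range,
    Function.Embedding.coeFn_mk]
  constructor
  · rintro ⟨p, ⟨h1, h2⟩, rfl⟩
    exact ⟨p.1, p.2, h1, h2, rfl, rfl⟩
  · rintro ⟨p, q, h1, h2, h3, h4⟩
    exact ⟨(p, q), ⟨h1, h2⟩, Subtype.ext (Prod.ext h3.symm h4.symm)⟩

theorem card_rhombus (n : ℕ) : (rhombus n).card = n * n := by
  simp [rhombus]

theorem rhombus_mono {m n : ℕ} (h : m ≤ n) : rhombus m ⊆ rhombus n := by
  intro f hf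
  obtain ⟨p, q, h1, h2, h3⟩ := mem_rhombus.1 hf
  exact mem_rhombus.2 ⟨p, q, by omega, by omega, h3⟩

/-- The faces through `topMid f` are `f` and its translates by `(1, 1)` and `(-1, 1)`, which are the
unit steps of the rhombus coordinates. -/
theorem mem_rhombus_succ {n : ℕ} {f g : Face} (hf : f ∈ rhombus n)
    (h : topMid f ∈ g.vertices) : g ∈ rhombus (n + 1) := by
  obtain ⟨p, q, h1, h2, h3, h4⟩ := mem_rhombus.1 hf
  have hg := Int.even_iff.1 g.2
  rw [mem_vertices, topMid] at h
  simp only at h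
  rw [mem_rhombus]
  have hcases : (g.1.1 = (p : ℤ) - q ∧ g.1.2 = (p : ℤ) + q) ∨
      (g.1.1 = (p : ℤ) - q + 1 ∧ g.1.2 = (p : ℤ) + q + 1) ∨
      (g.1.1 = (p : ℤ) - q - 1 ∧ g.1.2 = (p : ℤ) + q + 1) := by omega
  rcases hcases with hc | hc | hc
  · exact ⟨p, q, by omega, by omega, hc.1, hc.2⟩
  · exact ⟨p + 1, q, by omega, by omega, by push_cast; omega, by push_cast; omega⟩
  · exact ⟨p, q + 1, by omega, by omega, by push_cast; omega, by push_cast; omega⟩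

theorem IsTranslationInvariant.map_stab_eq {ω : QLA →ₗ[ℂ] ℂ} (hω : IsTranslationInvariant ω)
    (b : Bool) (f g : Face) : ω (stab b f) = ω (stab b g) := by
  let t : LatticeTranslation := ⟨g.1 - f.1, by
    rw [Prod.fst_sub, Prod.snd_sub, sub_add_sub_comm]
    exact g.2.sub f.2⟩
  have h : translateFace t f = g := Subtype.ext (add_sub_cancel f.1 g.1)
  rw [← h, ← translate_stab, hω]

/-- A translation invariant ground state is fixed by all stabilizers. -/
theorem IsGroundState.isStabilized {ω : QLA →ₗ[ℂ] ℂ} (hω : IsGroundState ω)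
    (ht : IsTranslationInvariant ω) : IsStabilized ω := by
  intro b f
  rw [hω.1.2]
  obtain ⟨h1, h2⟩ := Complex.le_def.1 (hω.1.map_stab_le_one b f)
  refine Complex.ext (le_antisymm h1 ?_) h2
  by_contra! hlt
  -- Area against boundary: the rhombi of side `n` and `n + 1` differ by `2 * n + 1` faces.
  have hn : ∀ n : ℕ, (n : ℝ) * n * (1 - (ω (stab b f)).re) ≤ 2 * (2 * n + 1) := by
    intro n
    have h := hω.sum_defect_le b (rhombus_mono n.le_succ) fun f hf g hg => mem_rhombus_succ hf hg
    rw [Finset.sum_congr rfl fun g _ => by rw [ht.map_stab_eq b g f], Finset.sum_const,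
      card_rhombus, card_rhombus, nsmul_eq_mul] at h
    have h3 := (Complex.le_def.1 h).1
    have e1 : (((n * n : ℕ) : ℂ) * (1 - ω (stab b f))).re
        = (n : ℝ) * n * (1 - (ω (stab b f)).re) := by
      rw [← Complex.ofReal_natCast, Complex.re_ofReal_mul]
      simp
    have e2 : (2 * (((n.succ * n.succ : ℕ) : ℂ) - (n * n : ℕ))).re = 2 * (2 * (n : ℝ) + 1) := by
      have : 2 * (((n.succ * n.succ : ℕ) : ℂ) - (n * n : ℕ)) = ((2 * (2 * n + 1) : ℕ) : ℂ) := by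
        push_cast
        ring
      rw [this, Complex.natCast_re]
      push_cast
      ring
    rwa [e1, e2] at h3
  set ε := 1 - (ω (stab b f)).re with hε
  have hpos : 0 < ε := by
    rw [Complex.one_re] at hlt
    linarith
  -- For `n ≥ 1` the bound `2 * (2 * n + 1)` is at most `6 * n`, which `n * n * ε` exceeds once `n *
  -- ε > 6`.
  obtain ⟨n, hn1⟩ := exists_nat_gt (6 / ε)
  rw [div_lt_iff₀ hpos] at hn1
  have h0 : (1 : ℝ) ≤ n := by
    rcases Nat.eq_zero_or_pos n with rfl | hp
    · simp at hn1
      linarith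
    · exact_mod_cast hp
  nlinarith [hn n]

end ColorCode

theorem mainTheorem3 :
    ∃ ω₀ : ColorCode.QLA →ₗ[ℂ] ℂ,
      (ColorCode.IsGroundState ω₀ ∧ ColorCode.IsTranslationInvariant ω₀) ∧
      (∀ ω : ColorCode.QLA →ₗ[ℂ] ℂ,
        ColorCode.IsGroundState ω → ColorCode.IsTranslationInvariant ω → ω = ω₀) ∧
      (∀ f : ColorCode.Face, ω₀ (ColorCode.K f) = 1 ∧ ω₀ (ColorCode.J f) = 1) ∧
      (∀ ω : ColorCode.QLA →ₗ[ℂ] ℂ, ColorCode.IsState ω →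
        (∀ f : ColorCode.Face, ω (ColorCode.K f) = 1 ∧ ω (ColorCode.J f) = 1) → ω = ω₀) ∧
      ColorCode.IsPureState ω₀ := by
  obtain ⟨ω₀, hω, hs⟩ := ColorCode.exists_stabilized_state
  have huniq : ∀ ω : ColorCode.QLA →ₗ[ℂ] ℂ, ColorCode.IsState ω → ColorCode.IsStabilized ω →
      ω = ω₀ := fun ω h h' => h'.unique h.1 hω.1 hs (h.2.trans hω.2.symm)
  refine ⟨ω₀, ⟨hs.isGroundState hω, hs.isTranslationInvariant hω⟩,
    fun ω hg ht => huniq ω hg.1 (hg.isStabilized ht), ?_, fun ω h hKJ => huniq ω h ?_,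
    hs.isPureState hω⟩
  · simpa only [hω.2] using ColorCode.isStabilized_iff.1 hs
  · rw [ColorCode.isStabilized_iff, h.2]
    exact hKJ
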